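/- Let $d\ge 1$. A convex body in $\mathbb{R}^d$ is a compact convex set with nonempty interior; $|\cdot|$ is Lebesgue measure, $\delta_K$ is the diameter of $K$, and $\|g\|_K:=\sup_{x\in K}|g(x)|$. Let $0<\mu_1\le\mu_2\le\cdots$ be real numbers and let $K\subseteq\mathbb{R}^d$ be a convex body such that $\sum_{j\ge1}\frac1{\mu_j}>\delta_K e$. Put $$N:=1+\sup\Big\{n\in\mathbb{N}:\ \sum_{j=1}^{n}\frac{1}{\delta_K\mu_j}<e\Big\},$$ which is then a (finite) positive integer. Let $\tilde\mu:[1,\infty)\to(0,\infty)$ be any increasing, continuous, piecewise $\mathcal{C}^1$ function (locally finitely many pieces, $\mathcal{C}^1$ up to the end points of each piece) with $\tilde\mu(k)=\mu_k$ for all integers $k\ge1$, and, if $N\ge 2$, set $$C_N:=4\exp\Big(4+\sup_{1\le s\le 2(N-1)}\frac{s\,\tilde\mu'(s)}{\tilde\mu(s)}\Big),$$ where $\tilde\mu'(s)$ denotes the left derivative for $s>1$ and the right derivative for $s=1$. Let $f$ be a real-valued function of class $\mathcal{C}^{2(N-1)}$ in an open neighborhood of $K$ such that $\|f\|_K>0$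 and $$\sum_{|\alpha|=j}\frac{j!}{\alpha!}\,\|f^{(\alpha)}\|_K\le\|f\|_K\,\mu_1\mu_2\cdots\mu_j,\qquad 0\le j\le 2(N-1).$$ Then, for each convex body $L\subseteq K$ such that $\|f\|_L=\|f\|_K$, if $N\ge2$, the function $\log|f|$ is integrable on $L$ and its mean oscillation over $L$ satisfies $$\frac1{|L|}\int_L\Big|\log|f(x)|-\frac1{|L|}\int_L\log|f(y)|\,dy\Big|\,dx\ \le\ 4(N-1)\big(\log(C_N d)+1\big).$$ (If $N=1$ the right-hand side is interpreted as $\infty$ and nothing is claimed.) -/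

import Mathlib

open MeasureTheory

noncomputable section

/-- A convex body in `ℝ^d`: a compact convex set with nonempty interior. -/
structure IsConvexBody {d : ℕ} (K : Set (EuclideanSpace ℝ (Fin d))) : Prop where
  convex : Convex ℝ K
  isCompact : IsCompact K
  nonempty_interior : (interior K).Nonempty

/-- An admissible weight all of whose elements are finite: `0 < μ₁ ≤ μ₂ ≤ ⋯`.
The value `μ 0` plays no role. -/
structure IsAdmissibleWeight (μ : ℕ → ℝ) : Prop where
  pos : ∀ j, 1 ≤ j → 0 < μ j
  mono : ∀ i j, 1 ≤ i → i ≤ j → μ i ≤ μ j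

/-- The infinite sum `∑_{j ≥ m} 1 / μ_j`, an element of `[0, ∞]`. -/
def weightTail (μ : ℕ → ℝ) (m : ℕ) : ENNReal :=
  ∑' j : ℕ, ENNReal.ofReal (1 / μ (m + j))

/-- `j₀(b)` is the least natural number `j` with `j ≥ log b⁻¹`. -/
def jZero (b : ℝ) : ℕ := ⌈Real.log b⁻¹⌉₊

/-- The `μ`-degree
`𝔡_μ(b) = sup {n ∈ ℕ : ∑_{j = j₀(b) + 1}^n 1 / μ_j < e} ∈ ℕ ∪ {∞}`. -/
def weightDegree (μ : ℕ → ℝ) (b : ℝ) : ℕ∞ :=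
  ⨆ n ∈ {n : ℕ | ∑ j ∈ Finset.Icc (jZero b + 1) n, 1 / μ j < Real.exp 1}, (n : ℕ∞)

/-- `(μ, K)` is admissible data with associated integer `N`:
`∑_{j ≥ 1} 1 / μ_j > δ_K e` and `N = 𝔡_{δ_K μ}(1) + 1`, where `δ_K = diam K`. -/
structure IsAdmissibleData {d : ℕ} (μ : ℕ → ℝ) (K : Set (EuclideanSpace ℝ (Fin d)))
    (N : ℕ) : Prop where
  weight : IsAdmissibleWeight μ
  body : IsConvexBody K
  tail : ENNReal.ofReal (Metric.diam K * Real.exp 1) < weightTail μ 1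
  integer : (N : ℕ∞) = weightDegree (fun j => Metric.diam K * μ j) 1 + 1

/-- The sup-norm `‖g‖_K = sup_{x ∈ K} |g x|`. -/
def supNormOn {d : ℕ} (K : Set (EuclideanSpace ℝ (Fin d)))
    (g : EuclideanSpace ℝ (Fin d) → ℝ) : ℝ :=
  sSup ((fun x => |g x|) '' K)

/-- The list of coordinate directions in which each `i` occurs `α i` times. -/
def directions {d : ℕ} (α : Fin d → ℕ) : List (Fin d) :=
  (List.finRange d).flatMap fun i => List.replicate (α i) i

/-- The partial derivative `f^(α)` of order `|α|`: the iterated derivative of `f` of order `|α|`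
evaluated at `α i` copies of the basis vector `e_i`, for each `i`. -/
def multiDeriv {d : ℕ} (α : Fin d → ℕ) (f : EuclideanSpace ℝ (Fin d) → ℝ)
    (x : EuclideanSpace ℝ (Fin d)) : ℝ :=
  iteratedFDeriv ℝ (directions α).length f x
    fun k => EuclideanSpace.single ((directions α).get k) (1 : ℝ)

/-- `‖f‖_{j,K} = ∑_{|α| = j} (j! / α!) ‖f^(α)‖_K`. -/
def derivNormOn {d : ℕ} (j : ℕ) (K : Set (EuclideanSpace ℝ (Fin d)))
    (f : EuclideanSpace ℝ (Fin d) → ℝ) : ℝ :=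
  ∑ α ∈ Finset.piAntidiag (Finset.univ : Finset (Fin d)) j,
    (Nat.multinomial Finset.univ α : ℝ) * supNormOn K (multiDeriv α f)

/-- `f` is `(μ^{|n}, M₀)`-smooth on `K`, for finite `n`: `M₀ > 0`, `f` is of class `C^n` in an open
neighbourhood of `K`, and `‖f‖_{j,K} ≤ M₀ μ₁ ⋯ μ_j` for `0 ≤ j ≤ n`. -/
structure IsWeightSmooth {d : ℕ} (μ : ℕ → ℝ) (n : ℕ) (M₀ : ℝ)
    (K : Set (EuclideanSpace ℝ (Fin d))) (f : EuclideanSpace ℝ (Fin d) → ℝ) : Prop where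
  pos : 0 < M₀
  contDiff : ∃ U, IsOpen U ∧ K ⊆ U ∧ ContDiffOn ℝ n f U
  bound : ∀ j ≤ n, derivNormOn j K f ≤ M₀ * ∏ i ∈ Finset.Icc 1 j, μ i

/-- `μt : [1, ∞) → (0, ∞)` is increasing, continuous and piecewise `C¹` (with locally finitely many
pieces, and `C¹` up to the end points of each piece), and interpolates `μ`. -/
structure IsWeightInterpolation (μ : ℕ → ℝ) (μt : ℝ → ℝ) : Prop where
  pos : ∀ s, 1 ≤ s → 0 < μt s
  mono : MonotoneOn μt (Set.Ici 1)
  cont : ContinuousOn μt (Set.Ici 1)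
  piecewise : ∃ t : ℕ → ℝ, t 0 = 1 ∧ StrictMono t ∧ Filter.Tendsto t Filter.atTop Filter.atTop ∧
    ∀ i, ContDiffOn ℝ 1 μt (Set.Icc (t i) (t (i + 1)))
  interp : ∀ k : ℕ, 1 ≤ k → μ k = μt k

/-- The derivative of a function on `[1, ∞)`, understood as the left derivative at points `s > 1`
and as the right derivative at the end point `s = 1`. -/
def leftDeriv (μt : ℝ → ℝ) (s : ℝ) : ℝ :=
  if 1 < s then derivWithin μt (Set.Iic s) s else derivWithin μt (Set.Ici 1) 1

/-- `γ_{μt}(n) = sup_{1 ≤ s ≤ n} s μt'(s) / μt(s)`. -/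
def gammaConst (μt : ℝ → ℝ) (n : ℕ) : ℝ :=
  sSup ((fun s => s * leftDeriv μt s / μt s) '' Set.Icc (1 : ℝ) n)

/-- `Γ_{μt}(n) = 4 e^{4 + γ_{μt}(n)}`. -/
def capGammaConst (μt : ℝ → ℝ) (n : ℕ) : ℝ :=
  4 * Real.exp (4 + gammaConst μt n)

/-- The mean oscillation of `g` over `L` (with respect to Lebesgue measure). -/
def meanOscillation {d : ℕ} (L : Set (EuclideanSpace ℝ (Fin d)))
    (g : EuclideanSpace ℝ (Fin d) → ℝ) : ℝ :=
  ⨍ x in L, |g x - ⨍ y in L, g y|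

end

/-! Write n = N - 1 and M = ‖f‖_K. Almost everywhere on L the function u = log M - log |f| is
nonnegative, so the mean oscillation of log |f| is at most twice the mean of u. That mean is
controlled by a Remez inequality (`volume_sublevel_le`): the part of L where |f| ≤ M η^(2n) has
measure at most C_N d η |L|. Thus the distribution function of u decays like e^(-t/(2n)), and
integrating it gives both integrability and the bound.

The Remez inequality is one-dimensional. Polar coordinates about a point of L where |f| = M reduce
it to segments that start at this maximum (`volume_le_mul_of_ray_density`); replacing r^(d-1) dr by
length costs the factor d.

On a segment two estimates compete (`IsDerivChain.remez`). Bang's argument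
(`IsDerivChain.exists_lt_abs`): the segment has length at most δ_K and, by the choice of N, e δ_K ≤
∑_{i ≤ N} 1/μ_i, so at no point can all derivatives of order at most n be small. Interpolation
(`IsDerivChain.abs_le_of_density`): if |f| ≤ ε on a subset of density θ of an interval, that subset
contains 2n well separated nodes, and Lagrange interpolation there makes all derivatives of order
below 2n small, up to a remainder. On intervals of length about n/μ_{2n} the remainder is at most
half of Bang's lower bound, and comparison bounds θ^(2n) by a constant to the power 2n times ε. The
logarithmic growth rate of the interpolating weight enters when μ_{2n}^k is compared with μ₁ ⋯ μ_k.
-/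

/-- The product `μ₁ ⋯ μ_j`. -/
noncomputable def weightProd (μ : ℕ → ℝ) (j : ℕ) : ℝ := ∏ i ∈ Finset.Icc 1 j, μ i

lemma weightProd_zero (μ : ℕ → ℝ) : weightProd μ 0 = 1 := by simp [weightProd]

lemma weightProd_succ (μ : ℕ → ℝ) (j : ℕ) :
    weightProd μ (j + 1) = weightProd μ j * μ (j + 1) := by
  rw [weightProd, Finset.prod_Icc_succ_top (by omega), weightProd]

lemma IsAdmissibleWeight.weightProd_pos {μ : ℕ → ℝ} (hμ : IsAdmissibleWeight μ) (j : ℕ) :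
    0 < weightProd μ j :=
  Finset.prod_pos fun i hi => hμ.pos i (Finset.mem_Icc.1 hi).1

/-! ### Derivative chains and Bang's lower bound -/

/-- `G 0, …, G m` are successive derivatives on the set `s`. -/
def IsDerivChain (m : ℕ) (G : ℕ → ℝ → ℝ) (s : Set ℝ) : Prop :=
  ∀ j < m, ∀ r ∈ s, HasDerivAt (G j) (G (j + 1) r) r

lemma IsDerivChain.mono {m m' : ℕ} {G : ℕ → ℝ → ℝ} {s t : Set ℝ} (h : IsDerivChain m G s)
    (hm : m' ≤ m) (hst : t ⊆ s) : IsDerivChain m' G t :=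
  fun j hj r hr => h j (hj.trans_le hm) r (hst hr)

lemma IsDerivChain.shift {m k : ℕ} {G : ℕ → ℝ → ℝ} {s : Set ℝ} (h : IsDerivChain (m + k) G s) :
    IsDerivChain m (fun j => G (j + k)) s := by
  intro j hj r hr
  have := h (j + k) (by omega) r hr
  rwa [show j + k + 1 = j + 1 + k by omega] at this

/-- If the derivatives of order `j < k` at `x` are bounded by `c e^j M_j` and the `k`-th one by
`c e^k M_k` throughout, then the bounds grow at most exponentially when moving to the left. -/
lemma IsDerivChain.le_exp {μ : ℕ → ℝ} (hμ : IsAdmissibleWeight μ) {k : ℕ} {G : ℕ → ℝ → ℝ}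
    {y x c : ℝ} (hc : 0 ≤ c) (hk0 : 0 < k) (hG : IsDerivChain k G (Set.Icc y x))
    (hx : ∀ j < k, |G j x| ≤ c * Real.exp j * weightProd μ j)
    (hk : ∀ r ∈ Set.Icc y x, |G k r| ≤ c * Real.exp k * weightProd μ k) :
    ∀ i ≤ k, ∀ r ∈ Set.Icc y x, |G (k - i) r| ≤
      c * Real.exp (k - i : ℕ) * weightProd μ (k - i) * Real.exp (Real.exp 1 * μ k * (x - r)) := by
  intro i
  induction i with
  | zero =>
    intro _ r hr
    refine (hk r hr).trans ?_
    have : 0 ≤ Real.exp 1 * μ k * (x - r) :=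
      mul_nonneg (mul_nonneg (Real.exp_pos _).le (hμ.pos k hk0).le) (by linarith [hr.2])
    have h1 : 0 ≤ c * Real.exp k * weightProd μ k :=
      mul_nonneg (mul_nonneg hc (Real.exp_pos _).le) (hμ.weightProd_pos k).le
    simpa using le_mul_of_one_le_right h1 (Real.one_le_exp this)
  | succ i ih =>
    intro hi r hr
    have ih := ih (by omega)
    obtain ⟨j, hj⟩ : ∃ j, k - (i + 1) = j := ⟨_, rfl⟩
    have hj1 : k - i = j + 1 := by omega
    rw [hj]
    rw [hj1] at ih
    have hjk : j < k := by omega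
    set A := c * Real.exp j * weightProd μ j with hA
    have hA0 : 0 ≤ A := mul_nonneg (mul_nonneg hc (Real.exp_pos _).le) (hμ.weightProd_pos j).le
    -- Comparison in the reflected variable s = x - r. The barrier A exp(e μ_k s) solves B' = e μ_k
    -- B, and the bound on the next derivative is A e μ_{j+1} exp(e μ_k s) ≤ B' because μ is
    -- nondecreasing.
    have key := image_norm_le_of_norm_deriv_right_le_deriv_boundary (a := 0) (b := x - r)
      (f := fun s => G j (x - s)) (f' := fun s => - G (j + 1) (x - s))
      (B := fun s => A * Real.exp (Real.exp 1 * μ k * s))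
      (B' := fun s => A * (Real.exp (Real.exp 1 * μ k * s) * (Real.exp 1 * μ k)))
      ?_ ?_ ?_ ?_ ?_ (x := x - r) ⟨by linarith [hr.2], le_rfl⟩
    · simpa using key
    · intro s hs
      have hd := hG j hjk (x - s) ⟨by linarith [hs.2, hr.1], by linarith [hs.1]⟩
      exact (hd.comp_const_sub x s).continuousAt.continuousWithinAt
    · intro s hs
      have hd := hG j hjk (x - s) ⟨by linarith [hs.2, hr.1], by linarith [hs.1]⟩
      exact (hd.comp_const_sub x s).hasDerivWithinAt
    · simpa using hx j hjk
    · intro s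
      have := ((hasDerivAt_id s).const_mul (Real.exp 1 * μ k)).exp.const_mul A
      simpa using this
    · intro s hs
      have h1 := ih (x - s) ⟨by linarith [hs.2, hr.1], by linarith [hs.1]⟩
      rw [norm_neg, Real.norm_eq_abs]
      refine h1.trans ?_
      rw [weightProd_succ, Nat.cast_add, Real.exp_add, Nat.cast_one, sub_sub_cancel]
      have hmono := hμ.mono (j + 1) k (by omega) hjk
      have : c * (Real.exp j * Real.exp 1) * (weightProd μ j * μ (j + 1)) *
          Real.exp (Real.exp 1 * μ k * s) =
          A * (Real.exp (Real.exp 1 * μ k * s) * (Real.exp 1 * μ (j + 1))) := by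
        rw [hA]; ring
      rw [this]
      gcongr

/-- Bang's lower bound: if `|G₀|` attains at the left end point its maximal admissible value and
the interval is short in terms of the weight, then no point can have all low-order derivatives
small. -/
lemma IsDerivChain.exists_lt_abs {μ : ℕ → ℝ} (hμ : IsAdmissibleWeight μ) {n : ℕ} {G : ℕ → ℝ → ℝ}
    {R : ℝ} (hG : IsDerivChain (n + 1) G (Set.Icc 0 R))
    (hM : ∀ j ≤ n + 1, ∀ r ∈ Set.Icc 0 R, |G j r| ≤ weightProd μ j)
    (h0 : 1 ≤ |G 0 0|) (hR : Real.exp 1 * R ≤ ∑ i ∈ Finset.Icc 1 (n + 1), 1 / μ i)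
    {x : ℝ} (hx : x ∈ Set.Icc 0 R) :
    ∃ j ≤ n, Real.exp (-(n + 1 : ℕ)) * Real.exp j * weightProd μ j < |G j x| := by
  by_contra! hcon
  -- Walk left from x. A step of length 1/(e μ_{k+1}) loses a factor e in the bounds and gives up
  -- the order k + 1, so after i steps the orders up to n + 1 - i are still controlled.
  have hstep : ∀ i ≤ n, ∀ y ∈ Set.Icc 0 x,
      Real.exp 1 * (x - y) ≤ ∑ l ∈ Finset.Ioc (n + 1 - i) (n + 1), 1 / μ l →
      ∀ j ≤ n + 1 - i,
        |G j y| ≤ Real.exp (-(n + 1 - i : ℕ)) * Real.exp j * weightProd μ j := by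
    intro i
    induction i with
    | zero =>
      intro _ y hy hS j hj
      have hxy : y = x := by
        have : Real.exp 1 * (x - y) ≤ 0 := by simpa using hS
        have h2 := Real.exp_pos 1
        nlinarith [hy.2]
      subst hxy
      rcases Nat.lt_or_ge j (n + 1) with h | h
      · simpa using hcon j (by omega)
      · obtain rfl : j = n + 1 := by simp at hj; omega
        rw [Nat.sub_zero, ← Real.exp_add, neg_add_cancel, Real.exp_zero, one_mul]
        exact hM _ le_rfl _ hx
    | succ i ih =>
      intro hi y hy hS j hj
      have ih := ih (by omega)
      obtain ⟨k, hk⟩ : ∃ k, n + 1 - (i + 1) = k := ⟨_, rfl⟩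
      have hk1 : n + 1 - i = k + 1 := by omega
      rw [hk] at hS hj ⊢
      rw [hk1] at ih
      have hμk := hμ.pos (k + 1) (by omega)
      have he := Real.exp_pos 1
      set S := ∑ l ∈ Finset.Ioc (k + 1) (n + 1), 1 / μ l with hSdef
      have hsum : ∑ l ∈ Finset.Ioc k (n + 1), 1 / μ l = 1 / μ (k + 1) + S := by
        rw [hSdef, ← Finset.sum_Ioc_consecutive _ (Nat.le_succ k) (by omega : k + 1 ≤ n + 1)]
        simp
      have hS0 : 0 ≤ S := Finset.sum_nonneg fun l hl =>
        (one_div_pos.2 (hμ.pos l (by simp at hl; omega))).le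
      -- The point z is within reach of the previous i steps, and the rest of the way to y is at
      -- most one further step of length 1/(e μ_{k+1}).
      set z := max y (x - S / Real.exp 1) with hz
      have hzx : z ≤ x := max_le hy.2 (by have : 0 ≤ S / Real.exp 1 := by positivity
                                          linarith)
      have hz0 : 0 ≤ z := hy.1.trans (le_max_left _ _)
      have hzy : Real.exp 1 * (z - y) ≤ 1 / μ (k + 1) := by
        rcases max_cases y (x - S / Real.exp 1) with ⟨h, _⟩ | ⟨h, _⟩
        · rw [hz, h, sub_self, mul_zero]; positivity
        · rw [hz, h]
          have : Real.exp 1 * (x - S / Real.exp 1 - y) = Real.exp 1 * (x - y) - S := by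
            field_simp
            ring
          rw [this]; linarith
      have hzS : Real.exp 1 * (x - z) ≤ S := by
        have : x - S / Real.exp 1 ≤ z := le_max_right _ _
        calc Real.exp 1 * (x - z) ≤ Real.exp 1 * (S / Real.exp 1) := by gcongr; linarith
          _ = S := by field_simp
      have hzb := ih z ⟨hz0, hzx⟩ hzS
      have hsub : Set.Icc y z ⊆ Set.Icc 0 R :=
        Set.Icc_subset_Icc hy.1 (hzx.trans hx.2)
      have := IsDerivChain.le_exp hμ (k := k + 1) (G := G) (y := y) (x := z)
        (c := Real.exp (-(k + 1 : ℕ))) (Real.exp_pos _).le k.succ_pos (hG.mono (by omega) hsub)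
        (fun j hj => hzb j (by omega)) (fun r hr => by
          rw [← Real.exp_add, neg_add_cancel, Real.exp_zero, one_mul]
          exact hM _ (by omega) r (hsub hr)) (k + 1 - j) (by omega) y
          ⟨le_rfl, le_max_left _ _⟩
      rw [show k + 1 - (k + 1 - j) = j by omega] at this
      refine this.trans ?_
      have h3 : Real.exp (Real.exp 1 * μ (k + 1) * (z - y)) ≤ Real.exp 1 := by
        apply Real.exp_le_exp.2
        calc Real.exp 1 * μ (k + 1) * (z - y) = μ (k + 1) * (Real.exp 1 * (z - y)) := by ring
          _ ≤ μ (k + 1) * (1 / μ (k + 1)) := by gcongr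
          _ = 1 := by field_simp
      have hw := (hμ.weightProd_pos j).le
      calc Real.exp (-(k + 1 : ℕ)) * Real.exp j * weightProd μ j * _
          ≤ Real.exp (-(k + 1 : ℕ)) * Real.exp j * weightProd μ j * Real.exp 1 := by gcongr
        _ = (Real.exp (-(k + 1 : ℕ)) * Real.exp 1) * Real.exp j * weightProd μ j := by ring
        _ = _ := by
          rw [← Real.exp_add]; push_cast; ring_nf
  have hμ1 := hμ.pos 1 le_rfl
  have he := Real.exp_pos 1
  set S := ∑ l ∈ Finset.Ioc 1 (n + 1), 1 / μ l with hSdef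
  have hsum : ∑ l ∈ Finset.Icc 1 (n + 1), 1 / μ l = 1 / μ 1 + S := by
    have : Finset.Icc 1 (n + 1) = Finset.Ioc 0 (n + 1) := by ext; simp; omega
    rw [this, hSdef, ← Finset.sum_Ioc_consecutive _ (Nat.zero_le 1) (by omega : 1 ≤ n + 1)]
    simp
  have hS0 : 0 ≤ S := Finset.sum_nonneg fun l hl =>
    (one_div_pos.2 (hμ.pos l (by simp at hl; omega))).le
  set z := max 0 (x - S / Real.exp 1) with hz
  have hzx : z ≤ x := max_le hx.1 (by have : 0 ≤ S / Real.exp 1 := by positivity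
                                      linarith)
  have hz0 : 0 ≤ z := le_max_left _ _
  have hzy : Real.exp 1 * z ≤ 1 / μ 1 := by
    rcases max_cases 0 (x - S / Real.exp 1) with ⟨h, _⟩ | ⟨h, _⟩
    · rw [hz, h, mul_zero]; positivity
    · rw [hz, h]
      have : Real.exp 1 * (x - S / Real.exp 1) = Real.exp 1 * x - S := by field_simp
      rw [this]
      have : Real.exp 1 * x ≤ Real.exp 1 * R := by gcongr; exact hx.2
      linarith
  have hzS : Real.exp 1 * (x - z) ≤ S := by
    have : x - S / Real.exp 1 ≤ z := le_max_right _ _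
    calc Real.exp 1 * (x - z) ≤ Real.exp 1 * (S / Real.exp 1) := by gcongr; linarith
      _ = S := by field_simp
  -- After n steps only the orders 0 and 1 remain: |G₀(z)| ≤ 1/e with z ≤ 1/(e μ₁). The mean value
  -- inequality gives |G₀(0)| ≤ 2/e < 1, a contradiction.
  have hzb := hstep n le_rfl z ⟨hz0, hzx⟩ (by simpa [hSdef] using hzS) 0 (by omega)
  have hmv : |G 0 z - G 0 0| ≤ μ 1 * (z - 0) := by
    have hsub : Set.Icc 0 z ⊆ Set.Icc 0 R := Set.Icc_subset_Icc le_rfl (hzx.trans hx.2)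
    refine norm_image_sub_le_of_norm_deriv_right_le_segment (f := G 0) (f' := G 1) (a := 0)
      (b := z) (fun r hr => (hG 0 (by omega) r (hsub hr)).continuousAt.continuousWithinAt)
      (fun r hr => (hG 0 (by omega) r (hsub ⟨hr.1, hr.2.le⟩)).hasDerivWithinAt)
      (fun r hr => ?_) z ⟨hz0, le_rfl⟩
    simpa [weightProd] using hM 1 (by omega) r (hsub ⟨hr.1, hr.2.le⟩)
  have hz1 : μ 1 * z ≤ Real.exp (-1) := by
    rw [Real.exp_neg]
    calc μ 1 * z = (Real.exp 1)⁻¹ * (μ 1 * (Real.exp 1 * z)) := by field_simp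
      _ ≤ (Real.exp 1)⁻¹ * (μ 1 * (1 / μ 1)) := by gcongr
      _ = _ := by field_simp
  have h5 : |G 0 z| ≤ Real.exp (-1) := by
    simpa [weightProd_zero] using hzb
  have h6 : Real.exp (-1) < 1 / 2 := by
    rw [Real.exp_neg, inv_lt_comm₀ he (by norm_num)]
    linarith [Real.exp_one_gt_d9]
  have h7 := abs_sub_abs_le_abs_sub (G 0 0) (G 0 z)
  rw [abs_sub_comm] at h7
  rw [sub_zero] at hmv
  linarith

/-! ### Lagrange interpolation at separated nodes -/

lemma gap_mul_le_sub {v : ℕ → ℝ} {h : ℝ} {m : ℕ} (hv : ∀ i, i + 1 < m → v i + h ≤ v (i + 1))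
    (i k : ℕ) (hik : i + k < m) : (k : ℝ) * h ≤ v (i + k) - v i := by
  induction k with
  | zero => simp
  | succ k ih =>
    have h1 := ih (by omega)
    have h2 := hv (i + k) (by omega)
    rw [← add_assoc]
    push_cast
    linarith

lemma injOn_of_gap {v : ℕ → ℝ} {h : ℝ} (hh : 0 < h) {m : ℕ}
    (hv : ∀ i, i + 1 < m → v i + h ≤ v (i + 1)) : Set.InjOn v (Finset.range m) := by
  intro i hi j hj hij
  simp only [Finset.coe_range, Set.mem_Iio] at hi hj
  by_contra hne
  rcases Nat.lt_or_gt_of_ne hne with hlt | hlt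
  · obtain ⟨k, rfl⟩ := Nat.exists_eq_add_of_lt hlt
    have := gap_mul_le_sub hv i (k + 1) (by omega)
    rw [← add_assoc, ← hij, sub_self] at this
    have : 0 < ((k + 1 : ℕ) : ℝ) * h := by positivity
    linarith
  · obtain ⟨k, rfl⟩ := Nat.exists_eq_add_of_lt hlt
    have := gap_mul_le_sub hv j (k + 1) (by omega)
    rw [← add_assoc, hij, sub_self] at this
    have : 0 < ((k + 1 : ℕ) : ℝ) * h := by positivity
    linarith

/-- For nodes with gaps at least `h`, the products in the denominators of Lagrange's interpolation
formula are bounded below as for equidistant nodes. -/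
lemma le_prod_abs_sub_of_gap {v : ℕ → ℝ} {h : ℝ} (hh : 0 ≤ h) {m : ℕ}
    (hv : ∀ i, i + 1 < m → v i + h ≤ v (i + 1)) (i k : ℕ) (hik : i + k + 1 ≤ m) :
    h ^ (i + k) * (i.factorial * k.factorial) ≤
      ∏ j ∈ (Finset.range (i + k + 1)).erase i, |v i - v j| := by
  induction k with
  | zero =>
    have h1 : (Finset.range (i + 0 + 1)).erase i = Finset.range i := by
      ext j; simp; omega
    have h2 : h ^ (i + 0) * (i.factorial * (0 : ℕ).factorial : ℝ) =
        ∏ j ∈ Finset.range i, ((i - j : ℕ) : ℝ) * h := by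
      rw [Finset.prod_mul_distrib, Finset.prod_const, Finset.card_range, mul_comm]
      simp only [Nat.factorial_zero, Nat.cast_one, mul_one, add_zero]
      congr 1
      rw [← Nat.cast_prod, ← Finset.prod_range_add_one_eq_factorial,
        ← Finset.prod_range_reflect]
      congr 1
      refine Finset.prod_congr rfl fun j hj => ?_
      have := Finset.mem_range.1 hj
      omega
    rw [h1, h2]
    refine Finset.prod_le_prod (fun j _ => by positivity) fun j hj => ?_
    have hj := Finset.mem_range.1 hj
    have := gap_mul_le_sub hv j (i - j) (by omega)
    rw [show j + (i - j) = i by omega] at this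
    exact this.trans (le_abs_self _)
  | succ k ih =>
    have ih := ih (by omega)
    have h1 : (Finset.range (i + (k + 1) + 1)).erase i =
        insert (i + (k + 1)) ((Finset.range (i + k + 1)).erase i) := by
      ext j; simp; omega
    rw [h1, Finset.prod_insert (by simp)]
    have h2 := gap_mul_le_sub hv i (k + 1) (by omega)
    have h3 : ((k + 1 : ℕ) : ℝ) * h ≤ |v i - v (i + (k + 1))| := by
      rw [abs_sub_comm]; exact h2.trans (le_abs_self _)
    calc h ^ (i + (k + 1)) * (i.factorial * (k + 1).factorial : ℝ)
        = (((k + 1 : ℕ) : ℝ) * h) * (h ^ (i + k) * (i.factorial * k.factorial)) := by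
          rw [Nat.factorial_succ]; push_cast; ring
      _ ≤ _ := by gcongr

/-- The binomial expansion of (1 + 1)^n divided by n!. It sums the reciprocals of the lower bounds
in `le_prod_abs_sub_of_gap`. -/
lemma sum_inv_factorial_mul_factorial (n : ℕ) :
    ∑ i ∈ Finset.range (n + 1), (1 : ℝ) / (i.factorial * (n - i).factorial) =
      2 ^ n / n.factorial := by
  rw [eq_div_iff (by positivity), Finset.sum_mul]
  have := congrArg (Nat.cast : ℕ → ℝ) (Nat.sum_range_choose n)
  push_cast at this
  rw [← this]
  refine Finset.sum_congr rfl fun i hi => ?_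
  rw [Nat.cast_choose ℝ (by simp at hi; omega)]
  ring

/-- Derivatives of a polynomial that is small at well separated nodes. -/
lemma abs_eval_iterate_derivative_le {v : ℕ → ℝ} {h a b ε : ℝ} (hh : 0 < h) {m : ℕ}
    (hv : ∀ i, i + 1 < m + 1 → v i + h ≤ v (i + 1)) (hvm : ∀ i < m + 1, v i ∈ Set.Icc a b)
    {P : Polynomial ℝ} (hP : P.degree < (m + 1 : ℕ)) (hε : ∀ i < m + 1, |P.eval (v i)| ≤ ε)
    {k : ℕ} (hk : k ≤ m) {x : ℝ} (hx : x ∈ Set.Icc a b) :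
    |(Polynomial.derivative^[k] P).eval x| ≤
      ε * (2 / h) ^ m * ((b - a) ^ (m - k) / (m - k).factorial) := by
  have hε0 : 0 ≤ ε := (abs_nonneg _).trans (hε 0 (by omega))
  have hinj := injOn_of_gap hh hv
  have hℓ : 0 ≤ b - a := by linarith [hx.1, hx.2]
  -- Differentiating each basis product k times leaves k! times the sum over all products of m - k
  -- of its m linear factors, each factor being at most b - a in absolute value.
  rw [Lagrange.eval_iterate_derivative_eq_sum hinj (by simpa using hP)
    (by simpa using Nat.lt_succ_of_le hk), abs_mul, Nat.abs_cast]
  have hterm : ∀ i ∈ Finset.range (m + 1),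
      |(P.eval (v i) / ∏ j ∈ (Finset.range (m + 1)).erase i, (v i - v j)) *
        ∑ t ∈ ((Finset.range (m + 1)).erase i).powersetCard
          ((Finset.range (m + 1)).card - (k + 1)), ∏ c ∈ t, (x - v c)| ≤
      (ε / h ^ m) * (m.choose k * (b - a) ^ (m - k)) *
        (1 / (i.factorial * (m - i).factorial)) := by
    intro i hi
    have hi := Finset.mem_range.1 hi
    have h1 := le_prod_abs_sub_of_gap hh.le hv i (m - i) (by omega)
    rw [show i + (m - i) = m by omega] at h1
    have h2 : |∑ t ∈ ((Finset.range (m + 1)).erase i).powersetCard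
          ((Finset.range (m + 1)).card - (k + 1)), ∏ c ∈ t, (x - v c)| ≤
          m.choose k * (b - a) ^ (m - k) := by
      refine (Finset.abs_sum_le_sum_abs _ _).trans ?_
      refine (Finset.sum_le_card_nsmul _ _ ((b - a) ^ (m - k)) fun t ht => ?_).trans ?_
      · rw [Finset.mem_powersetCard] at ht
        rw [Finset.abs_prod]
        refine (Finset.prod_le_prod (fun _ _ => abs_nonneg _) (g := fun _ => b - a)
          fun c hc => ?_).trans ?_
        · have hc := Finset.mem_erase.1 (ht.1 hc)
          have := hvm c (Finset.mem_range.1 hc.2)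
          rw [abs_le]
          constructor <;> linarith [this.1, this.2, hx.1, hx.2]
        · rw [Finset.prod_const, ht.2, Finset.card_range, Nat.add_sub_add_right]
      · rw [Finset.card_powersetCard, Finset.card_erase_of_mem (by simpa using hi)]
        simp only [Finset.card_range, Nat.add_sub_add_right, Nat.add_sub_cancel]
        rw [Nat.choose_symm hk, nsmul_eq_mul]
    rw [abs_mul, abs_div, Finset.abs_prod]
    have h3 : |P.eval (v i)| / ∏ j ∈ (Finset.range (m + 1)).erase i, |v i - v j| ≤
        ε / (h ^ m * (i.factorial * (m - i).factorial)) := by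
      gcongr
      exact hε i hi
    calc _ ≤ ε / (h ^ m * (i.factorial * (m - i).factorial)) *
          (m.choose k * (b - a) ^ (m - k)) := by gcongr
      _ = _ := by field_simp
  refine (mul_le_mul_of_nonneg_left ((Finset.abs_sum_le_sum_abs _ _).trans
    (Finset.sum_le_sum hterm)) (by positivity)).trans (le_of_eq ?_)
  -- The constants combine as k! · (m choose k) · 2^m / m! = 2^m / (m - k)!.
  rw [← Finset.mul_sum, sum_inv_factorial_mul_factorial, Nat.cast_choose ℝ hk, div_pow]
  field_simp

/-! ### Rolle's theorem and the interpolation error -/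

/-- Rolle's theorem for a finite set of zeros. -/
lemma exists_zeros_deriv {H H' : ℝ → ℝ} {a b : ℝ}
    (hH : ∀ r ∈ Set.Icc a b, HasDerivAt H (H' r) r) {k : ℕ} {s : Finset ℝ}
    (hs : s.card = k + 1) (hsub : ∀ r ∈ s, r ∈ Set.Icc a b ∧ H r = 0) :
    ∃ t : Finset ℝ, t.card = k ∧ ∀ r ∈ t, r ∈ Set.Icc a b ∧ H' r = 0 := by
  set z := s.orderEmbOfFin hs with hz
  have hzs : ∀ i, z i ∈ s := fun i => s.orderEmbOfFin_mem hs i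
  have hex : ∀ i : Fin k, ∃ c ∈ Set.Ioo (z i.castSucc) (z i.succ), H' c = 0 := by
    intro i
    have hlt : z i.castSucc < z i.succ := z.strictMono Fin.castSucc_lt_succ
    have hsub' : Set.Icc (z i.castSucc) (z i.succ) ⊆ Set.Icc a b :=
      Set.Icc_subset_Icc (hsub _ (hzs _)).1.1 (hsub _ (hzs _)).1.2
    refine exists_hasDerivAt_eq_zero hlt
      (fun r hr => (hH r (hsub' hr)).continuousAt.continuousWithinAt) ?_
      fun r hr => hH r (hsub' (Set.Ioo_subset_Icc_self hr))
    rw [(hsub _ (hzs _)).2, (hsub _ (hzs _)).2]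
  choose w hw hw0 using hex
  have hmono : StrictMono w := by
    intro i j hij
    exact ((hw i).2.trans_le (z.monotone (by
      rw [Fin.le_def, Fin.val_succ, Fin.val_castSucc]; exact hij))).trans (hw j).1
  refine ⟨Finset.univ.image w, ?_, ?_⟩
  · rw [Finset.card_image_of_injective _ hmono.injective]; simp
  · intro r hr
    obtain ⟨i, -, rfl⟩ := Finset.mem_image.1 hr
    exact ⟨⟨(hsub _ (hzs _)).1.1.trans (hw i).1.le, (hw i).2.le.trans (hsub _ (hzs _)).1.2⟩, hw0 i⟩

lemma IsDerivChain.exists_zeros {m : ℕ} {H : ℕ → ℝ → ℝ} {a b : ℝ}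
    (hH : IsDerivChain m H (Set.Icc a b)) {k : ℕ} {s : Finset ℝ}
    (hs : s.card = k) (hsub : ∀ r ∈ s, r ∈ Set.Icc a b ∧ H 0 r = 0) (j : ℕ) (hj : j ≤ m)
    (hjk : j ≤ k) :
    ∃ t : Finset ℝ, t.card = k - j ∧ ∀ r ∈ t, r ∈ Set.Icc a b ∧ H j r = 0 := by
  induction j with
  | zero => exact ⟨s, by simpa using hs, hsub⟩
  | succ j ih =>
    obtain ⟨t, ht, ht'⟩ := ih (by omega) (by omega)
    exact exists_zeros_deriv (hH j (by omega)) (k := k - (j + 1)) (by omega) ht'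

lemma IsDerivChain.polynomial (P : Polynomial ℝ) (m : ℕ) (s : Set ℝ) :
    IsDerivChain m (fun j r => (Polynomial.derivative^[j] P).eval r) s := by
  intro j _ r _
  simp only [Function.iterate_succ_apply']
  exact Polynomial.hasDerivAt _ r

lemma IsDerivChain.sub {m : ℕ} {G H : ℕ → ℝ → ℝ} {s : Set ℝ} (hG : IsDerivChain m G s)
    (hH : IsDerivChain m H s) : IsDerivChain m (fun j r => G j r - H j r) s :=
  fun j hj r hr => (hG j hj r hr).sub (hH j hj r hr)

/-- The error bound of Lagrange interpolation. -/
lemma IsDerivChain.abs_le_of_zeros {k : ℕ} {H : ℕ → ℝ → ℝ} {a b C : ℝ}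
    (hH : IsDerivChain k H (Set.Icc a b)) {s : Finset ℝ}
    (hs : s.card = k) (hsub : ∀ r ∈ s, r ∈ Set.Icc a b ∧ H 0 r = 0)
    (hC : ∀ r ∈ Set.Icc a b, |H k r| ≤ C) {x : ℝ} (hx : x ∈ Set.Icc a b) :
    |H 0 x| ≤ C * ((b - a) ^ k / k.factorial) := by
  have hC0 : 0 ≤ C := (abs_nonneg _).trans (hC x hx)
  have hℓ : 0 ≤ b - a := by linarith [hx.1, hx.2]
  by_cases hxs : x ∈ s
  · rw [(hsub x hxs).2, abs_zero]; positivity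
  set Q : Polynomial ℝ := Lagrange.nodal s id with hQ
  have hQx : Q.eval x ≠ 0 := by
    rw [hQ, Lagrange.eval_nodal, Finset.prod_ne_zero_iff]
    intro c hc h0
    rw [id, sub_eq_zero] at h0
    exact hxs (h0 ▸ hc)
  -- This c gives H₀ - cQ an extra zero at x. With k + 1 zeros, Rolle yields ξ where its k-th
  -- derivative H_k - c k! vanishes, Q being monic of degree k.
  set c := H 0 x / Q.eval x with hc
  have hchain := hH.sub (IsDerivChain.polynomial (Polynomial.C c * Q) k (Set.Icc a b))
  obtain ⟨t, ht, ht'⟩ := hchain.exists_zeros (k := k + 1) (s := insert x s)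
    (by rw [Finset.card_insert_of_notMem hxs, hs]) (by
      intro r hr
      rcases Finset.mem_insert.1 hr with rfl | hr
      · refine ⟨hx, ?_⟩
        simp only [Function.iterate_zero, id, Polynomial.eval_mul, Polynomial.eval_C]
        rw [hc, div_mul_cancel₀ _ hQx, sub_self]
      · refine ⟨(hsub r hr).1, ?_⟩
        have : Q.eval r = 0 := Lagrange.eval_nodal_at_node (v := id) hr
        simp [this, (hsub r hr).2]) k le_rfl (by omega)
  obtain ⟨ξ, hξ⟩ := Finset.card_pos.1 (by omega : 0 < t.card)
  have hξ' := ht' ξ hξ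
  have hder : (Polynomial.derivative^[k] (Polynomial.C c * Q)).eval ξ = c * k.factorial := by
    have hdeg : Q.natDegree = k := by rw [hQ, Lagrange.natDegree_nodal, hs]
    have hmon : Q.Monic := Lagrange.nodal_monic
    rw [Polynomial.iterate_derivative_C_mul, Polynomial.eval_mul, Polynomial.eval_C]
    congr 1
    have h1 : (Polynomial.derivative^[k] Q).natDegree = 0 := by
      have := Polynomial.natDegree_iterate_derivative Q k
      omega
    rw [Polynomial.eq_C_of_natDegree_eq_zero h1, Polynomial.eval_C,
      Polynomial.coeff_iterate_derivative, zero_add, ← hdeg]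
    simp [Nat.descFactorial_self, hmon.coeff_natDegree]
  have hck : c * k.factorial = H k ξ := by
    have := hξ'.2
    simp only [hder] at this
    linarith
  have hQb : |Q.eval x| ≤ (b - a) ^ k := by
    rw [hQ, Lagrange.eval_nodal, Finset.abs_prod, ← hs, ← Finset.prod_const]
    refine Finset.prod_le_prod (fun _ _ => abs_nonneg _) fun y hy => ?_
    have := (hsub y hy).1
    rw [id, abs_le]
    constructor <;> linarith [this.1, this.2, hx.1, hx.2]
  have hHx : H 0 x = H k ξ / k.factorial * Q.eval x := by
    rw [← hck, hc]; field_simp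
  rw [hHx, abs_mul, abs_div, Nat.abs_cast]
  calc |H k ξ| / k.factorial * |Q.eval x| ≤ C / k.factorial * (b - a) ^ k := by
        gcongr; exact hC ξ hξ'.1
    _ = _ := by ring

/-- If `|G₀| ≤ ε` at well separated nodes, then all derivatives of order at most `m` are controlled
on the whole interval. -/
lemma IsDerivChain.abs_le_of_nodes {m : ℕ} {G : ℕ → ℝ → ℝ} {v : ℕ → ℝ} {h a b ε C : ℝ}
    (hG : IsDerivChain (m + 1) G (Set.Icc a b)) (hh : 0 < h)
    (hv : ∀ i, i + 1 < m + 1 → v i + h ≤ v (i + 1)) (hvm : ∀ i < m + 1, v i ∈ Set.Icc a b)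
    (hε : ∀ i < m + 1, |G 0 (v i)| ≤ ε) (hC : ∀ r ∈ Set.Icc a b, |G (m + 1) r| ≤ C)
    {k : ℕ} (hk : k ≤ m) {x : ℝ} (hx : x ∈ Set.Icc a b) :
    |G k x| ≤ ε * (2 / h) ^ m * ((b - a) ^ (m - k) / (m - k).factorial) +
      C * ((b - a) ^ (m + 1 - k) / (m + 1 - k).factorial) := by
  have hinj := injOn_of_gap hh hv
  set P := Lagrange.interpolate (Finset.range (m + 1)) v (fun i => G 0 (v i)) with hPdef
  have hPv : ∀ i < m + 1, P.eval (v i) = G 0 (v i) := fun i hi =>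
    Lagrange.eval_interpolate_at_node _ hinj (Finset.mem_range.2 hi)
  have hPdeg : P.degree < (m + 1 : ℕ) := by
    have := Lagrange.degree_interpolate_lt (r := fun i => G 0 (v i)) hinj
    rwa [Finset.card_range] at this
  have h1 := abs_eval_iterate_derivative_le hh hv hvm hPdeg
    (fun i hi => by rw [hPv i hi]; exact hε i hi) hk hx
  have hchain := hG.sub (IsDerivChain.polynomial P (m + 1) (Set.Icc a b))
  -- G₀ - P vanishes at the m + 1 nodes, so its k-th derivative has m + 1 - k zeros. The error bound
  -- applies to that derivative, whose own derivative of order m + 1 - k is G_{m+1} because P has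
  -- degree at most m.
  obtain ⟨t, ht, ht'⟩ := hchain.exists_zeros (k := m + 1) (s := (Finset.range (m + 1)).image v)
    (by rw [Finset.card_image_of_injOn hinj, Finset.card_range]) (by
      intro r hr
      obtain ⟨i, hi, rfl⟩ := Finset.mem_image.1 hr
      have hi := Finset.mem_range.1 hi
      exact ⟨hvm i hi, by simp [hPv i hi]⟩) k (by omega) (by omega)
  have hchain' : IsDerivChain (m + 1 - k + k)
      (fun j r => G j r - (Polynomial.derivative^[j] P).eval r) (Set.Icc a b) := by
    rwa [Nat.sub_add_cancel (by omega)]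
  have h2 := hchain'.shift.abs_le_of_zeros (C := C) ht (by simpa using ht') (by
    intro r hr
    simp only [Nat.sub_add_cancel (by omega : k ≤ m + 1)]
    rw [Polynomial.iterate_derivative_eq_zero_of_degree_lt hPdeg]
    simpa using hC r hr) hx
  simp only [zero_add] at h2
  calc |G k x| = |(Polynomial.derivative^[k] P).eval x +
        (G k x - (Polynomial.derivative^[k] P).eval x)| := by congr 1; ring
    _ ≤ _ := (abs_add_le _ _).trans (add_le_add h1 h2)

/-! ### Nodes in sets of positive density -/

/-- Greedy choice: take the least point x of A and discard [x, x + h], which costs measure at most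
h. Compactness provides the least point at every stage. -/
lemma exists_separated_points {h : ℝ} (hh : 0 < h) (m : ℕ) {A : Set ℝ} (hA : IsCompact A)
    (hm : m * h < volume.real A) :
    ∃ v : ℕ → ℝ, (∀ i < m + 1, v i ∈ A) ∧ ∀ i, i + 1 < m + 1 → v i + h ≤ v (i + 1) := by
  have hne : ∀ {B : Set ℝ}, 0 < volume.real B → B.Nonempty := by
    intro B hB
    by_contra h
    rw [Set.not_nonempty_iff_eq_empty] at h
    simp [h] at hB
  induction m generalizing A with
  | zero =>
    obtain ⟨x, hx⟩ := hne (by simpa using hm)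
    exact ⟨fun _ => x, fun i _ => hx, fun i hi => by omega⟩
  | succ m ih =>
    have hm0 : 0 ≤ (m : ℝ) * h := by positivity
    push_cast at hm
    obtain ⟨x, hxA, hx⟩ := hA.exists_isLeast (hne (by linarith))
    have hA' : IsCompact (A ∩ Set.Ici (x + h)) := hA.inter_right isClosed_Ici
    have hcov : A ⊆ (A ∩ Set.Ici (x + h)) ∪ Set.Icc x (x + h) := by
      intro y hy
      rcases le_total (x + h) y with h1 | h1
      · exact Or.inl ⟨hy, h1⟩
      · exact Or.inr ⟨hx hy, h1⟩
    have hle : volume.real A ≤ volume.real (A ∩ Set.Ici (x + h)) + h := by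
      calc volume.real A ≤ volume.real ((A ∩ Set.Ici (x + h)) ∪ Set.Icc x (x + h)) :=
            measureReal_mono hcov (by
              exact (hA'.union isCompact_Icc).measure_lt_top.ne)
        _ ≤ _ := measureReal_union_le _ _
        _ = _ := by rw [Real.volume_real_Icc_of_le (by linarith)]; ring
    obtain ⟨v, hv, hv'⟩ := ih hA' (by linarith)
    refine ⟨fun i => Nat.casesOn i x v, ?_, ?_⟩
    · rintro (_ | i) hi
      · exact hxA
      · exact (hv i (by omega)).1
    · rintro (_ | i) hi
      · exact (hv 0 (by omega)).2
      · exact hv' i (by omega)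

/-- Pigeonhole: one of the q equal pieces of [0, R] contains at least the average share of E, so the
density of E in it is no smaller than in [0, R]. -/
lemma exists_le_measureReal_inter {E : Set ℝ} {R : ℝ} (hER : E ⊆ Set.Icc 0 R) {q : ℕ}
    (hq : 0 < q) (hR : 0 < R) :
    ∃ i < q, volume.real E / q ≤
      volume.real (E ∩ Set.Icc (i * (R / q)) ((i + 1) * (R / q))) := by
  by_contra! hcon
  have hfin : ∀ B : Set ℝ, volume (E ∩ B) ≠ ⊤ := fun B =>
    ((measure_mono (Set.inter_subset_left.trans hER)).trans_lt measure_Icc_lt_top).ne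
  have hcov : E ⊆ ⋃ i ∈ Finset.range q, E ∩ Set.Icc (i * (R / q)) ((i + 1) * (R / q)) := by
    intro x hx
    have hx' := hER hx
    simp only [Set.mem_iUnion, Finset.mem_range]
    have hq0 : (0 : ℝ) < q := by exact_mod_cast hq
    have hRq : 0 < R / q := by positivity
    rcases hx'.2.lt_or_eq with hlt | heq
    · refine ⟨⌊x / (R / q)⌋₊, ?_, hx, ?_, ?_⟩
      · rw [Nat.floor_lt (div_nonneg hx'.1 hRq.le), div_lt_iff₀ hRq]
        field_simp; exact hlt
      · rw [← le_div_iff₀ hRq]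
        exact Nat.floor_le (div_nonneg hx'.1 hRq.le)
      · rw [← div_le_iff₀ hRq]
        exact (Nat.lt_floor_add_one _).le
    -- The floor would give the index q at the right end point, which belongs to the last piece.
    · refine ⟨q - 1, by omega, hx, ?_, ?_⟩
      · rw [heq, Nat.cast_sub hq]
        have : ((q : ℝ) - (1 : ℕ)) * (R / q) = R - R / q := by push_cast; field_simp
        rw [this]; linarith
      · rw [heq, Nat.cast_sub hq]
        have : ((q : ℝ) - (1 : ℕ) + 1) * (R / q) = R := by push_cast; field_simp; ring
        rw [this]
  have h1 : volume.real E ≤ ∑ i ∈ Finset.range q,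
      volume.real (E ∩ Set.Icc (i * (R / q)) ((i + 1) * (R / q))) :=
    (measureReal_mono hcov (by
      refine ((measure_mono (Set.iUnion₂_subset fun i _ => Set.inter_subset_left.trans
        hER)).trans_lt measure_Icc_lt_top).ne)).trans (measureReal_biUnion_finset_le _ _)
  have h2 : ∑ i ∈ Finset.range q,
      volume.real (E ∩ Set.Icc (i * (R / q)) ((i + 1) * (R / q))) <
      ∑ i ∈ Finset.range q, volume.real E / q :=
    Finset.sum_lt_sum_of_nonempty ⟨0, Finset.mem_range.2 hq⟩
      fun i hi => hcon i (Finset.mem_range.1 hi)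
  rw [Finset.sum_const, Finset.card_range, nsmul_eq_mul,
    mul_div_cancel₀ _ (by positivity : (q : ℝ) ≠ 0)] at h2
  linarith

/-- Control of derivatives on an interval by the values on a subset of positive density `θ`. -/
lemma IsDerivChain.abs_le_of_density {m : ℕ} {G : ℕ → ℝ → ℝ} {a b ε θ C : ℝ}
    (hG : IsDerivChain (m + 1) G (Set.Icc a b)) (hab : a < b) (hθ : 0 < θ) {A : Set ℝ}
    (hA : IsCompact A) (hAJ : A ⊆ Set.Icc a b) (hAθ : θ * (b - a) ≤ volume.real A)
    (hε : ∀ r ∈ A, |G 0 r| ≤ ε) (hC : ∀ r ∈ Set.Icc a b, |G (m + 1) r| ≤ C)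
    {k : ℕ} (hk : k ≤ m) {x : ℝ} (hx : x ∈ Set.Icc a b) :
    |G k x| ≤ ε / θ ^ m * (2 * (m + 1) / (b - a)) ^ k * Real.exp (2 * (m + 1)) +
      C * ((b - a) ^ (m + 1 - k) / (m + 1 - k).factorial) := by
  have hℓ : 0 < b - a := by linarith
  -- The m gaps have total length strictly below θ (b - a), hence below the measure of A, as the
  -- greedy choice requires.
  set h := θ * (b - a) / (m + 1) with hh
  have hh0 : 0 < h := by positivity
  obtain ⟨v, hvA, hv⟩ := exists_separated_points hh0 m hA (by
    refine lt_of_lt_of_le ?_ hAθ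
    rw [hh, mul_div_assoc', div_lt_iff₀ (by positivity)]
    nlinarith [mul_pos hθ hℓ])
  have hε0 : 0 ≤ ε := (abs_nonneg _).trans (hε _ (hvA 0 (by omega)))
  refine (hG.abs_le_of_nodes hh0 hv (fun i hi => hAJ (hvA i hi)) (fun i hi => hε _ (hvA i hi))
    hC hk hx).trans (add_le_add_left ?_ _)
  have h1 : (2 * ((m : ℝ) + 1)) ^ (m - k) / (m - k).factorial ≤ Real.exp (2 * (m + 1)) :=
    Real.pow_div_factorial_le_exp _ (by positivity) _
  have h2 : ε * (2 / h) ^ m * ((b - a) ^ (m - k) / (m - k).factorial) =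
      ε / θ ^ m * (2 * (m + 1) / (b - a)) ^ k *
        ((2 * ((m : ℝ) + 1)) ^ (m - k) / (m - k).factorial) := by
    have h3 : (2 : ℝ) / h = (2 * (m + 1) / (b - a)) / θ := by rw [hh]; field_simp
    have h4 : (2 * (m + 1) / (b - a)) ^ m * (b - a) ^ (m - k) =
        (2 * (m + 1) / (b - a)) ^ k * (2 * ((m : ℝ) + 1)) ^ (m - k) := by
      conv_lhs => rw [← Nat.add_sub_cancel' hk, pow_add, mul_assoc, Nat.add_sub_cancel' hk,
        ← mul_pow, div_mul_cancel₀ _ hℓ.ne']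
    rw [h3, div_pow]
    calc ε * ((2 * (m + 1) / (b - a)) ^ m / θ ^ m) * ((b - a) ^ (m - k) / (m - k).factorial)
        = ε / θ ^ m * ((2 * (m + 1) / (b - a)) ^ m * (b - a) ^ (m - k)) / (m - k).factorial := by
          ring
      _ = _ := by rw [h4]; ring
  rw [h2]
  gcongr

/-! ### Weight estimates and the Remez inequality on an interval -/

lemma prod_Icc_eq_factorial (k : ℕ) : ∏ i ∈ Finset.Icc 1 k, i = k.factorial := by
  induction k with
  | zero => simp
  | succ k ih => rw [Finset.prod_Icc_succ_top (by omega), ih, Nat.factorial_succ, mul_comm]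

/-- Multiplying the hypothesis over i ≤ k leaves the factor (p^k / k!)^γ ≤ e^(pγ). This reverses the
trivial bound μ₁ ⋯ μ_k ≤ μ_p^k at an exponential cost. -/
lemma IsAdmissibleWeight.pow_le_weightProd_mul {μ : ℕ → ℝ} (hμ : IsAdmissibleWeight μ) {γ : ℝ}
    (hγ0 : 0 ≤ γ) {p : ℕ} (hγ : ∀ i, 1 ≤ i → i ≤ p → μ p ≤ μ i * ((p : ℝ) / i) ^ γ) {k : ℕ}
    (hk : k ≤ p) : μ p ^ k ≤ weightProd μ k * Real.exp (p * γ) := by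
  rcases Nat.eq_zero_or_pos p with rfl | hp
  · obtain rfl : k = 0 := by omega
    simp [weightProd_zero]
  calc μ p ^ k = ∏ i ∈ Finset.Icc 1 k, μ p := by simp
    _ ≤ ∏ i ∈ Finset.Icc 1 k, μ i * ((p : ℝ) / i) ^ γ := by
      refine Finset.prod_le_prod (fun _ _ => (hμ.pos p hp).le) fun i hi => ?_
      rw [Finset.mem_Icc] at hi
      exact hγ i hi.1 (hi.2.trans hk)
    _ = weightProd μ k * ((p : ℝ) ^ k / k.factorial) ^ γ := by
      rw [Finset.prod_mul_distrib, Real.finsetProd_rpow _ _ (fun i _ => by positivity),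
        Finset.prod_div_distrib, Finset.prod_const, ← Nat.cast_prod,
        prod_Icc_eq_factorial]
      simp [weightProd]
    _ ≤ weightProd μ k * (Real.exp p) ^ γ := by
      have := (hμ.weightProd_pos k).le
      gcongr
      exact Real.pow_div_factorial_le_exp _ (by positivity) _
    _ = _ := by rw [← Real.exp_mul]

lemma IsAdmissibleWeight.weightProd_le_mul_pow {μ : ℕ → ℝ} (hμ : IsAdmissibleWeight μ) {p k : ℕ}
    (hk : k ≤ p) : weightProd μ p ≤ weightProd μ k * μ p ^ (p - k) := by
  have hsplit : weightProd μ p = weightProd μ k * ∏ i ∈ Finset.Ioc k p, μ i := by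
    rw [weightProd, weightProd]
    have h1 : ∀ q, Finset.Icc 1 q = Finset.Ioc 0 q := fun q => by ext; simp; omega
    rw [h1, h1, Finset.prod_Ioc_consecutive _ (Nat.zero_le k) hk]
  have h2 : ∏ i ∈ Finset.Ioc k p, μ i ≤ μ p ^ (p - k) := by
    rw [← Nat.card_Ioc, ← Finset.prod_const]
    refine Finset.prod_le_prod (fun i hi => ?_) fun i hi => ?_
    · rw [Finset.mem_Ioc] at hi
      exact (hμ.pos i (by omega)).le
    · rw [Finset.mem_Ioc] at hi
      exact hμ.mono i p (by omega) hi.2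
  rw [hsplit]
  exact mul_le_mul_of_nonneg_left h2 (hμ.weightProd_pos k).le

/-- **Remez inequality on an interval** for a function with controlled derivatives whose maximum
is attained at the left end point. -/
theorem IsDerivChain.remez {μ : ℕ → ℝ} (hμ : IsAdmissibleWeight μ) {γ : ℝ} (hγ0 : 0 ≤ γ) {n : ℕ}
    (hn : 1 ≤ n)
    (hγ : ∀ i, 1 ≤ i → i ≤ 2 * n → μ (2 * n) ≤ μ i * (((2 * n : ℕ) : ℝ) / i) ^ γ)
    {G : ℕ → ℝ → ℝ} {R : ℝ} (hR : 0 < R) (hG : IsDerivChain (2 * n) G (Set.Icc 0 R))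
    (hM : ∀ j ≤ 2 * n, ∀ r ∈ Set.Icc 0 R, |G j r| ≤ weightProd μ j) (h0 : 1 ≤ |G 0 0|)
    (hB : Real.exp 1 * R ≤ ∑ i ∈ Finset.Icc 1 (n + 1), 1 / μ i)
    {E : Set ℝ} (hE : IsCompact E) (hER : E ⊆ Set.Icc 0 R) {ε : ℝ} (hε0 : 0 ≤ ε)
    (hε : ∀ r ∈ E, |G 0 r| ≤ ε) :
    (volume.real E / (4 * Real.exp (4 + γ) * R)) ^ (2 * n) ≤ ε := by
  rcases (measureReal_nonneg (μ := volume) (s := E)).eq_or_lt with hE0 | hEpos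
  · rw [← hE0, zero_div, zero_pow (by omega)]; exact hε0
  obtain ⟨m, hm⟩ : ∃ m, 2 * n = m + 1 := ⟨2 * n - 1, by omega⟩
  set θ := volume.real E / R with hθ
  have hθ0 : 0 < θ := by positivity
  have hθ1 : θ ≤ 1 := by
    rw [hθ, div_le_one hR]
    have := measureReal_mono (μ := volume) hER measure_Icc_lt_top.ne
    rwa [Real.volume_real_Icc_of_le hR.le, sub_zero] at this
  have hmR : 2 * ((m : ℝ) + 1) = 4 * n := by
    have : ((m + 1 : ℕ) : ℝ) = ((2 * n : ℕ) : ℝ) := by rw [hm]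
    push_cast at this; linarith
  have hn1 : (1 : ℝ) ≤ n := by exact_mod_cast hn
  set X := ε / θ ^ m with hX
  have hX0 : 0 ≤ X := by positivity
  have hΓ : (4 * Real.exp (4 + γ)) ^ (2 * n) = 16 ^ n * Real.exp (8 * n + 2 * n * γ) := by
    rw [mul_pow, ← Real.exp_nat_mul, pow_mul]
    push_cast
    congr 2
    · norm_num
    · ring
  -- Since θ ≤ 1 and m = 2n - 1, a lower bound for X = ε / θ^m suffices; the factor here is the
  -- 2n-th power of 4 e^(4 + γ).
  have hfin : 1 ≤ X * (16 ^ n * Real.exp (8 * n + 2 * n * γ)) →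
      (volume.real E / (4 * Real.exp (4 + γ) * R)) ^ (2 * n) ≤ ε := by
    intro h
    have h1 : volume.real E / (4 * Real.exp (4 + γ) * R) = θ / (4 * Real.exp (4 + γ)) := by
      rw [hθ]; field_simp
    rw [h1, div_pow, hΓ, div_le_iff₀ (by positivity)]
    calc θ ^ (2 * n) ≤ θ ^ m := pow_le_pow_of_le_one hθ0.le hθ1 (by omega)
      _ ≤ θ ^ m * (X * (16 ^ n * Real.exp (8 * n + 2 * n * γ))) :=
        le_mul_of_one_le_right (by positivity) h
      _ = _ := by rw [hX]; field_simp
  have hμp := hμ.pos (2 * n) (by omega)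
  -- At this length the remainder of order k is at most M_k e^(-3(2n - k)) e^n = M_k e^(-5n + 3k),
  -- where M_k = μ₁ ⋯ μ_k. For k ≤ n this is at most half of Bang's bound M_k e^(k - n - 1).
  set ℓ₀ := Real.exp (-3) * n / μ (2 * n) with hℓ₀
  have hℓ₀0 : 0 < ℓ₀ := by positivity
  have hrem : ∀ ℓ : ℝ, 0 < ℓ → ℓ ≤ ℓ₀ → ∀ k ≤ n,
      weightProd μ (2 * n) * (ℓ ^ (2 * n - k) / (2 * n - k).factorial) ≤
        weightProd μ k * Real.exp (-5 * n + 3 * k) := by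
    intro ℓ hℓ hℓℓ k hk
    have hw := (hμ.weightProd_pos k).le
    have h1 : μ (2 * n) * ℓ ≤ Real.exp (-3) * n := by
      calc μ (2 * n) * ℓ ≤ μ (2 * n) * ℓ₀ := by gcongr
        _ = _ := by rw [hℓ₀]; field_simp
    calc weightProd μ (2 * n) * (ℓ ^ (2 * n - k) / (2 * n - k).factorial)
        ≤ (weightProd μ k * μ (2 * n) ^ (2 * n - k)) *
            (ℓ ^ (2 * n - k) / (2 * n - k).factorial) := by
          gcongr
          exact hμ.weightProd_le_mul_pow (by omega)
      _ = weightProd μ k * ((μ (2 * n) * ℓ) ^ (2 * n - k) / (2 * n - k).factorial) := by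
          rw [mul_pow]; ring
      _ ≤ weightProd μ k * ((Real.exp (-3) * n) ^ (2 * n - k) / (2 * n - k).factorial) := by
          gcongr
      _ = weightProd μ k * (Real.exp (-3) ^ (2 * n - k) *
            ((n : ℝ) ^ (2 * n - k) / (2 * n - k).factorial)) := by
          rw [mul_pow]; ring
      _ ≤ weightProd μ k * (Real.exp (-3) ^ (2 * n - k) * Real.exp n) := by
          gcongr
          exact Real.pow_div_factorial_le_exp _ (by positivity) _
      _ = _ := by
          rw [← Real.exp_nat_mul, ← Real.exp_add, Nat.cast_sub (by omega)]
          congr 2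
          push_cast
          ring
  have hhalf : Real.exp (-1) ≤ 1 / 2 := by
    rw [Real.exp_neg, inv_le_comm₀ (Real.exp_pos 1) (by norm_num)]
    linarith [Real.exp_one_gt_d9]
  have h2n : (2 : ℝ) ≤ 2 ^ n := by
    calc (2 : ℝ) = 2 ^ 1 := by norm_num
      _ ≤ 2 ^ n := pow_le_pow_right₀ (by norm_num) hn
  have h816 : (16 : ℝ) ^ n = 2 ^ n * 8 ^ n := by rw [← mul_pow]; norm_num
  have hγn : 0 ≤ 2 * n * γ := by positivity
  rw [hm] at hG
  rcases le_or_gt R ℓ₀ with hcase | hcase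
  -- Short interval: no subdivision and no Bang estimate are needed, since |G₀(0)| ≥ 1 is already a
  -- lower bound of order 0.
  · apply hfin
    have h1 := hG.abs_le_of_density (θ := θ) (ε := ε) (C := weightProd μ (2 * n)) hR hθ0 hE hER
      (by rw [hθ, sub_zero, div_mul_cancel₀ _ hR.ne']) hε
      (by rw [← hm]; exact hM (2 * n) le_rfl) (Nat.zero_le m) (x := 0) ⟨le_rfl, hR.le⟩
    rw [← hm, hmR, sub_zero] at h1
    have h3 : Real.exp (-5 * n + 3 * (0 : ℕ)) ≤ Real.exp (-1) := by
      apply Real.exp_le_exp.2; push_cast; linarith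
    have h2 := hrem R hR hcase 0 (Nat.zero_le _)
    rw [weightProd_zero, one_mul] at h2
    have h2' := h0.trans (h1.trans (add_le_add_right (h2.trans (h3.trans hhalf)) _))
    have h4 : 1 ≤ X * (2 * Real.exp (4 * n)) := by
      rw [← hX, pow_zero, mul_one] at h2'
      linarith
    refine h4.trans ?_
    have h5 : Real.exp (4 * n) ≤ Real.exp (8 * n + 2 * n * γ) := by
      apply Real.exp_le_exp.2; linarith
    have h6 : (2 : ℝ) ≤ 16 ^ n := by
      rw [h816]
      have : (1 : ℝ) ≤ 8 ^ n := one_le_pow₀ (by norm_num)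
      nlinarith
    gcongr
  -- Long interval: cut it into q equal pieces of length between ℓ₀/2 and ℓ₀, keep one where E has
  -- density at least θ, and apply Bang's bound at its left end point.
  · set q := ⌈R / ℓ₀⌉₊ with hq
    have hRℓ : 1 < R / ℓ₀ := by rwa [one_lt_div hℓ₀0]
    have hq0 : 0 < q := Nat.ceil_pos.2 (by linarith)
    have hqR : (0 : ℝ) < q := by exact_mod_cast hq0
    have hq1 : R / ℓ₀ ≤ q := Nat.le_ceil _
    have hq2 : (q : ℝ) < R / ℓ₀ + 1 := Nat.ceil_lt_add_one (by linarith)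
    set ℓ := R / q with hℓ
    have hℓpos : 0 < ℓ := by positivity
    have hℓ1 : ℓ ≤ ℓ₀ := by
      rw [hℓ, div_le_iff₀ hqR]
      rw [div_le_iff₀ hℓ₀0] at hq1
      linarith
    have hℓ2 : ℓ₀ / 2 ≤ ℓ := by
      rw [hℓ, le_div_iff₀ hqR]
      have : (q : ℝ) ≤ 2 * (R / ℓ₀) := by linarith
      calc ℓ₀ / 2 * q ≤ ℓ₀ / 2 * (2 * (R / ℓ₀)) := by gcongr
        _ = R := by field_simp
    obtain ⟨i, hi, hiE⟩ := exists_le_measureReal_inter hER hq0 hR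
    rw [← hℓ] at hiE
    have hiq : ((i : ℝ) + 1) ≤ q := by exact_mod_cast hi
    have hsub : Set.Icc (i * ℓ) ((i + 1) * ℓ) ⊆ Set.Icc 0 R := by
      refine Set.Icc_subset_Icc (by positivity) ?_
      calc ((i : ℝ) + 1) * ℓ ≤ q * ℓ := by gcongr
        _ = R := by rw [hℓ]; field_simp
    have hlen : ((i : ℝ) + 1) * ℓ - i * ℓ = ℓ := by ring
    have hmem : (i : ℝ) * ℓ ∈ Set.Icc (i * ℓ) ((i + 1) * ℓ) := ⟨le_rfl, by linarith⟩
    obtain ⟨k, hk, hbang⟩ := IsDerivChain.exists_lt_abs hμ (hG.mono (by omega) subset_rfl)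
      (fun j hj => hM j (by omega)) h0 hB (hsub hmem)
    have h1 := (hG.mono le_rfl hsub).abs_le_of_density (θ := θ) (ε := ε)
      (C := weightProd μ (2 * n)) (by linarith) hθ0
      (hE.inter_right isClosed_Icc) Set.inter_subset_right
      (by rw [hlen]; refine le_trans (le_of_eq ?_) hiE; rw [hθ, hℓ]; field_simp)
      (fun r hr => hε r hr.1)
      (by rw [← hm]; exact fun r hr => hM (2 * n) le_rfl r (hsub hr))
      (by omega : k ≤ m) hmem
    rw [← hm, hmR, hlen] at h1
    have h2 := hrem ℓ hℓpos hℓ1 k hk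
    have hw := hμ.weightProd_pos k
    have hkn : (k : ℝ) ≤ n := by exact_mod_cast hk
    have h3 : Real.exp (-5 * n + 3 * k) ≤ 1 / 2 * Real.exp (-(n + 1 : ℕ) + k) := by
      calc Real.exp (-5 * n + 3 * k) ≤ Real.exp (-1 + (-(n + 1 : ℕ) + k)) := by
            apply Real.exp_le_exp.2; push_cast; linarith
        _ = Real.exp (-1) * Real.exp (-(n + 1 : ℕ) + k) := Real.exp_add _ _
        _ ≤ _ := by gcongr
    have h4 : (4 * n / ℓ) ^ k ≤ 8 ^ k * Real.exp (3 * k) *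
        (weightProd μ k * Real.exp (2 * n * γ)) := by
      have h5 : 4 * n / ℓ ≤ 8 * Real.exp 3 * μ (2 * n) := by
        calc 4 * n / ℓ ≤ 4 * n / (ℓ₀ / 2) := by gcongr
          _ = 8 * Real.exp 3 * μ (2 * n) := by
            rw [hℓ₀, Real.exp_neg]; field_simp; norm_num
      have h6 := hμ.pow_le_weightProd_mul hγ0 hγ (k := k) (by omega)
      push_cast at h6
      calc (4 * n / ℓ) ^ k ≤ (8 * Real.exp 3 * μ (2 * n)) ^ k := by gcongr
        _ = 8 ^ k * Real.exp (3 * k) * μ (2 * n) ^ k := by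
          rw [mul_pow, mul_pow, ← Real.exp_nat_mul, mul_comm (k : ℝ)]
        _ ≤ _ := by gcongr
    rw [← Real.exp_add] at hbang
    have h7 : Real.exp (-(n + 1 : ℕ) + k) * weightProd μ k <
        X * (8 ^ k * Real.exp (3 * k) * (weightProd μ k * Real.exp (2 * n * γ))) *
          Real.exp (4 * n) + weightProd μ k * (1 / 2 * Real.exp (-(n + 1 : ℕ) + k)) := by
      refine (hbang.trans_le h1).trans_le (add_le_add ?_ (h2.trans ?_))
      · gcongr
      · gcongr
    have h8 : Real.exp (-(n + 1 : ℕ) + k) / 2 <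
        X * (8 ^ k * Real.exp (3 * k + 2 * n * γ + 4 * n)) := by
      rw [Real.exp_add (3 * k + 2 * n * γ), Real.exp_add (3 * k : ℝ)]
      have : 0 < weightProd μ k * (X * (8 ^ k * (Real.exp (3 * k) * Real.exp (2 * n * γ) *
          Real.exp (4 * n))) - Real.exp (-(n + 1 : ℕ) + k) / 2) := by linarith
      have := pos_of_mul_pos_right this hw.le
      linarith
    apply hfin
    have h9 : 1 ≤ X * (8 ^ k * Real.exp (3 * k + 2 * n * γ + 4 * n)) *
        (2 * Real.exp ((n + 1 : ℕ) - k)) := by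
      have : Real.exp (-(n + 1 : ℕ) + k) / 2 * (2 * Real.exp ((n + 1 : ℕ) - k)) = 1 := by
        rw [div_mul_eq_mul_div, mul_left_comm, mul_div_assoc, ← Real.exp_add,
          show (-((n + 1 : ℕ) : ℝ) + k + ((n + 1 : ℕ) - k)) = 0 by ring, Real.exp_zero]
        norm_num
      rw [← this]
      gcongr
    refine h9.trans ?_
    have h10 : X * (8 ^ k * Real.exp (3 * k + 2 * n * γ + 4 * n)) *
        (2 * Real.exp ((n + 1 : ℕ) - k)) =
        X * (2 * 8 ^ k * Real.exp (2 * k + 5 * n + 1 + 2 * n * γ)) := by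
      rw [show (2 * k + 5 * n + 1 + 2 * n * γ : ℝ) =
        (3 * k + 2 * n * γ + 4 * n) + ((n + 1 : ℕ) - k) by push_cast; ring,
        Real.exp_add (3 * k + 2 * n * γ + 4 * n)]
      ring
    rw [h10, h816]
    -- With k ≤ n and 1 ≤ n, one has 2 · 8^k ≤ 2^n · 8^n and 2k + 5n + 1 ≤ 8n.
    gcongr
    · norm_num
    · linarith

/-! ### Iterated directional derivatives -/

section IteratedDirectional
variable {E : Type*} [NormedAddCommGroup E] [NormedSpace ℝ E]

/-- Iterated directional derivative along the vectors of a list, the head being the last one. -/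
noncomputable def listDeriv (f : E → ℝ) : List E → E → ℝ
  | [] => f
  | v :: l => fun x => fderiv ℝ (listDeriv f l) x v

lemma contDiffOn_listDeriv {f : E → ℝ} {U : Set E} (hU : IsOpen U) (l : List E) {n m : ℕ}
    (hf : ContDiffOn ℝ n f U) (hm : m + l.length ≤ n) : ContDiffOn ℝ m (listDeriv f l) U := by
  induction l generalizing m with
  | nil => exact hf.of_le (by exact_mod_cast hm)
  | cons v l ih =>
    have h1 := ih (m := m + 1) (by simp at hm; omega)
    exact (h1.fderiv_of_isOpen hU (by exact_mod_cast le_rfl)).clm_apply contDiffOn_const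

/-- Adjacent transpositions generate all permutations, so symmetry of second derivatives is enough.
The swap occurs at the head of the list, where two orders of differentiability are still available.
-/
lemma listDeriv_perm {f : E → ℝ} {U : Set E} (hU : IsOpen U) {n : ℕ} (hf : ContDiffOn ℝ n f U)
    {l l' : List E} (h : l.Perm l') (hn : l.length ≤ n) :
    ∀ x ∈ U, listDeriv f l x = listDeriv f l' x := by
  induction h with
  | nil => exact fun x _ => rfl
  | cons v h ih =>
    intro x hx
    have ih := ih (by simp at hn; omega)
    have : listDeriv f _ =ᶠ[nhds x] listDeriv f _ :=
      Filter.eventuallyEq_of_mem (hU.mem_nhds hx) ih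
    simp only [listDeriv]
    rw [this.fderiv_eq]
  | swap v w l =>
    intro x hx
    have hC : ContDiffAt ℝ 2 (listDeriv f l) x :=
      (contDiffOn_listDeriv hU l (m := 2) hf (by simp at hn; omega)).contDiffAt
        (hU.mem_nhds hx)
    have hsymm := hC.isSymmSndFDerivAt (by simp)
    have hd : DifferentiableAt ℝ (fderiv ℝ (listDeriv f l)) x :=
      (hC.fderiv_right (m := 1) (by norm_num)).differentiableAt (by norm_num)
    have key : ∀ a b : E, listDeriv f (a :: b :: l) x =
        fderiv ℝ (fderiv ℝ (listDeriv f l)) x a b := by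
      intro a b
      simp only [listDeriv]
      rw [fderiv_clm_apply hd (differentiableAt_const b)]
      simp
    rw [key, key, hsymm.eq]
  | trans h1 h2 ih1 ih2 =>
    intro x hx
    rw [ih1 hn x hx, ih2 (h1.length_eq ▸ hn) x hx]

lemma iteratedFDeriv_eq_listDeriv {f : E → ℝ} {U : Set E} (hU : IsOpen U) {n : ℕ}
    (hf : ContDiffOn ℝ n f U) {j : ℕ} (hj : j ≤ n) (v : Fin j → E) :
    ∀ x ∈ U, iteratedFDeriv ℝ j f x v = listDeriv f (List.ofFn v) x := by
  induction j with
  | zero => intro x _; simp [listDeriv]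
  | succ j ih =>
    intro x hx
    have hd : DifferentiableAt ℝ (iteratedFDeriv ℝ j f) x :=
      (hf.contDiffAt (hU.mem_nhds hx)).differentiableAt_iteratedFDeriv (by exact_mod_cast hj)
    rw [iteratedFDeriv_succ_apply_left, List.ofFn_succ]
    have h1 : (fun y => iteratedFDeriv ℝ j f y (Fin.tail v)) =ᶠ[nhds x]
        listDeriv f (List.ofFn (Fin.tail v)) :=
      Filter.eventuallyEq_of_mem (hU.mem_nhds hx) (ih (by omega) (Fin.tail v))
    simp only [listDeriv]
    have h2 : (fun i : Fin j => v i.succ) = Fin.tail v := rfl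
    rw [h2, ← h1.fderiv_eq]
    have := (hd.hasFDerivAt.continuousMultilinear_apply_const (Fin.tail v)).fderiv
    rw [this]
    rfl

end IteratedDirectional

/-! ### Words, multi-indices and directional derivatives -/

lemma count_ofFn {α : Type*} [DecidableEq α] {j : ℕ} (p : Fin j → α) (a : α) :
    (List.ofFn p).count a = ∑ k, if p k = a then 1 else 0 := by
  induction j with
  | zero => simp
  | succ j ih =>
    rw [List.ofFn_succ, List.count_cons, ih, Fin.sum_univ_succ, add_comm]
    simp

/-- Grouping the words of length `j` in `d` letters by the multiplicities of the letters. -/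
lemma sum_words_eq_sum_multinomial {d : ℕ} (j : ℕ) (F : (Fin d → ℕ) → ℝ) :
    ∑ p : Fin j → Fin d, F (fun i => (List.ofFn p).count i) =
      ∑ α ∈ Finset.piAntidiag (Finset.univ : Finset (Fin d)) j,
        (Nat.multinomial Finset.univ α : ℝ) * F α := by
  -- Φ is the linear functional sending the monomial X^s to F(s). Applied to the two expansions of
  -- (∑ X_i)^j, over words and by the multinomial theorem, it gives the identity.
  set Φ := (MvPolynomial.basisMonomials (Fin d) ℝ).constr ℝ (fun s => F s) with hΦ
  have hΦm : ∀ s : Fin d →₀ ℕ, Φ (MvPolynomial.monomial s 1) = F s := by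
    intro s
    have := (MvPolynomial.basisMonomials (Fin d) ℝ).constr_basis ℝ (fun s => F s) s
    simpa using this
  have h1 := Finset.sum_pow_eq_sum_piAntidiag (Finset.univ : Finset (Fin d))
    (fun i => (MvPolynomial.X i : MvPolynomial (Fin d) ℝ)) j
  rw [Fintype.sum_pow] at h1
  have h2 := congrArg Φ h1
  rw [map_sum, map_sum] at h2
  convert h2 using 2 with p hp α hα
  · have : (∏ i, (MvPolynomial.X (p i) : MvPolynomial (Fin d) ℝ)) =
        MvPolynomial.monomial (∑ i, Finsupp.single (p i) 1) 1 := by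
      rw [MvPolynomial.monomial_sum_one]
      rfl
    rw [this, hΦm]
    congr 1
    funext i
    rw [Finsupp.finsetSum_apply]
    simp only [Finsupp.single_apply]
    rw [count_ofFn]
  · have : (Nat.multinomial Finset.univ α : MvPolynomial (Fin d) ℝ) *
        ∏ i, (MvPolynomial.X i : MvPolynomial (Fin d) ℝ) ^ α i =
        (Nat.multinomial Finset.univ α : ℝ) •
          MvPolynomial.monomial (Finsupp.equivFunOnFinite.symm α) 1 := by
      rw [MvPolynomial.smul_eq_C_mul, MvPolynomial.monomial_eq]
      simp [Finsupp.prod_fintype]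
    rw [this, map_smul, hΦm]
    rfl

lemma count_directions {d : ℕ} (α : Fin d → ℕ) (i : Fin d) : (directions α).count i = α i := by
  rw [directions, List.count_flatMap]
  have : (List.map (List.count i ∘ fun j => List.replicate (α j) j) (List.finRange d)) =
      (List.finRange d).map fun j => if j = i then α j else 0 := by
    refine List.map_congr_left fun j _ => ?_
    simp [List.count_replicate]
  rw [this, ← List.ofFn_eq_map, List.sum_ofFn]
  simp

section MultiDeriv
variable {d : ℕ} {f : EuclideanSpace ℝ (Fin d) → ℝ} {U : Set (EuclideanSpace ℝ (Fin d))} {n : ℕ}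

lemma length_directions (α : Fin d → ℕ) : (directions α).length = ∑ i, α i := by
  rw [directions, List.length_flatMap]
  simp [← List.ofFn_eq_map, List.sum_ofFn]

lemma multiDeriv_eq_listDeriv (hU : IsOpen U) (hf : ContDiffOn ℝ n f U) {α : Fin d → ℕ}
    (hα : ∑ i, α i ≤ n) {x : EuclideanSpace ℝ (Fin d)} (hx : x ∈ U) :
    multiDeriv α f x =
      listDeriv f ((directions α).map fun i => EuclideanSpace.single i (1 : ℝ)) x := by
  rw [multiDeriv, iteratedFDeriv_eq_listDeriv hU hf (by rwa [length_directions]) _ x hx]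
  congr 1
  refine List.ext_getElem (by simp) fun i h1 h2 => by simp

lemma continuousOn_multiDeriv (hU : IsOpen U) (hf : ContDiffOn ℝ n f U) {α : Fin d → ℕ}
    (hα : ∑ i, α i ≤ n) : ContinuousOn (multiDeriv α f) U := by
  refine ContinuousOn.congr (f := listDeriv f ((directions α).map
    fun i => EuclideanSpace.single i (1 : ℝ))) ?_ fun x hx => multiDeriv_eq_listDeriv hU hf hα hx
  exact (contDiffOn_listDeriv hU _ (m := 0) hf (by
    rw [List.length_map, length_directions]; omega)).continuousOn

lemma iteratedFDeriv_single_eq_multiDeriv (hU : IsOpen U) (hf : ContDiffOn ℝ n f U) {j : ℕ}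
    (hj : j ≤ n) (p : Fin j → Fin d) {x : EuclideanSpace ℝ (Fin d)} (hx : x ∈ U) :
    iteratedFDeriv ℝ j f x (fun k => EuclideanSpace.single (p k) (1 : ℝ)) =
      multiDeriv (fun i => (List.ofFn p).count i) f x := by
  have hperm : (List.ofFn p).Perm (directions fun i => (List.ofFn p).count i) :=
    List.perm_iff_count.2 fun i => by rw [count_directions]
  have hlen := hperm.length_eq
  rw [List.length_ofFn, length_directions] at hlen
  rw [multiDeriv_eq_listDeriv hU hf (by omega) hx, iteratedFDeriv_eq_listDeriv hU hf hj _ x hx]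
  rw [show (fun k => EuclideanSpace.single (p k) (1 : ℝ)) =
    (fun i => EuclideanSpace.single i (1 : ℝ)) ∘ p from rfl, ← List.map_ofFn]
  exact listDeriv_perm hU hf (hperm.map _) (by simpa using hj) x hx

lemma abs_le_supNormOn {K : Set (EuclideanSpace ℝ (Fin d))} (hK : IsCompact K)
    {g : EuclideanSpace ℝ (Fin d) → ℝ} (hg : ContinuousOn g K) {x : EuclideanSpace ℝ (Fin d)}
    (hx : x ∈ K) : |g x| ≤ supNormOn K g :=
  le_csSup (hK.bddAbove_image hg.abs) ⟨x, hx, rfl⟩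

/-- The iterated derivative in the direction of a unit vector is bounded by the norm
`‖f‖_{j,K}`. -/
lemma abs_iteratedFDeriv_le_derivNormOn (hU : IsOpen U) (hf : ContDiffOn ℝ n f U)
    {K : Set (EuclideanSpace ℝ (Fin d))} (hK : IsCompact K) (hKU : K ⊆ U) {j : ℕ} (hj : j ≤ n)
    {θ : EuclideanSpace ℝ (Fin d)} (hθ : ‖θ‖ = 1) {x : EuclideanSpace ℝ (Fin d)} (hx : x ∈ K) :
    |iteratedFDeriv ℝ j f x (fun _ => θ)| ≤ derivNormOn j K f := by
  have hθsum : θ = ∑ i, θ i • EuclideanSpace.single i (1 : ℝ) := by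
    ext k
    simp [Finset.sum_apply, Pi.single_apply]
  have hθi : ∀ i, |θ i| ≤ 1 := fun i => by
    have := PiLp.norm_apply_le θ i
    rwa [hθ] at this
  -- Multilinear expansion over words. The coefficients are products of coordinates of a unit
  -- vector, hence at most 1 in absolute value.
  have h1 : iteratedFDeriv ℝ j f x (fun _ => θ) = ∑ p : Fin j → Fin d,
      (∏ k, θ (p k)) • multiDeriv (fun i => (List.ofFn p).count i) f x := by
    conv_lhs => rw [hθsum]
    rw [ContinuousMultilinearMap.map_sum]
    refine Finset.sum_congr rfl fun p _ => ?_
    rw [ContinuousMultilinearMap.map_smul_univ, iteratedFDeriv_single_eq_multiDeriv hU hf hj p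
      (hKU hx)]
  rw [h1, derivNormOn, ← sum_words_eq_sum_multinomial j (fun α => supNormOn K (multiDeriv α f))]
  refine (Finset.abs_sum_le_sum_abs _ _).trans (Finset.sum_le_sum fun p _ => ?_)
  rw [smul_eq_mul, abs_mul, Finset.abs_prod]
  have h2 : ∏ k, |θ (p k)| ≤ 1 := Finset.prod_le_one (fun _ _ => abs_nonneg _) fun k _ => hθi _
  have h3 : ∑ i, (List.ofFn p).count i ≤ n := by
    have hperm : (List.ofFn p).Perm (directions fun i => (List.ofFn p).count i) :=
      List.perm_iff_count.2 fun i => by rw [count_directions]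
    have hlen := hperm.length_eq
    rw [List.length_ofFn, length_directions] at hlen
    omega
  calc _ ≤ 1 * |multiDeriv (fun i => (List.ofFn p).count i) f x| := by gcongr
    _ ≤ _ := by
      rw [one_mul]
      exact abs_le_supNormOn hK ((continuousOn_multiDeriv hU hf h3).mono hKU) hx

/-- The restrictions of the derivatives of `f` to a line. -/
lemma isDerivChain_iteratedFDeriv (hU : IsOpen U) (hf : ContDiffOn ℝ n f U)
    (x θ : EuclideanSpace ℝ (Fin d)) {s : Set ℝ} (hs : ∀ r ∈ s, x + r • θ ∈ U) :
    IsDerivChain n (fun j r => iteratedFDeriv ℝ j f (x + r • θ) (fun _ => θ)) s := by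
  intro j hj r hr
  have hd : DifferentiableAt ℝ (iteratedFDeriv ℝ j f) (x + r • θ) :=
    (hf.contDiffAt (hU.mem_nhds (hs r hr))).differentiableAt_iteratedFDeriv (by exact_mod_cast hj)
  have hline : HasDerivAt (fun r : ℝ => x + r • θ) θ r := by
    simpa using ((hasDerivAt_id r).smul_const θ).const_add x
  have h1 := hd.hasFDerivAt.continuousMultilinear_apply_const (fun _ => θ)
  have h2 := h1.comp_hasDerivAt r hline
  exact h2

end MultiDeriv

/-! ### Growth of the interpolated weight -/

section WeightInterpolation
variable {μ : ℕ → ℝ} {μt : ℝ → ℝ}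

/-- The piece is taken half-open so that at a break point the left derivative is read off from the
piece ending there. -/
lemma leftDeriv_eq_derivWithin_Icc {a b s : ℝ} (ha : 1 ≤ a)
    (h : ContDiffOn ℝ 1 μt (Set.Icc a b)) (hs : s ∈ Set.Ioc a b) :
    leftDeriv μt s = derivWithin μt (Set.Icc a b) s := by
  rw [leftDeriv, if_pos (ha.trans_lt hs.1)]
  have h1 := (h.differentiableOn one_ne_zero s ⟨hs.1.le, hs.2⟩).hasDerivWithinAt
  have h2 : HasDerivWithinAt μt (derivWithin μt (Set.Icc a b) s) (Set.Iic s) s := by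
    refine (h1.mono (Set.Icc_subset_Icc_right hs.2)).mono_of_mem_nhdsWithin ?_
    exact Icc_mem_nhdsLE hs.1
  exact h2.derivWithin (uniqueDiffWithinAt_Iic s)

/-- Without boundedness the real supremum in `gammaConst` would be the default value 0 and bound
nothing. Finitely many compact pieces, with continuous one-sided derivatives, cover the interval. -/
lemma IsWeightInterpolation.bddAbove (h : IsWeightInterpolation μ μt) (P : ℝ) :
    BddAbove ((fun s => s * leftDeriv μt s / μt s) '' Set.Icc 1 P) := by
  obtain ⟨t, ht0, htm, htt, hC⟩ := h.piecewise
  have h1t : ∀ k, 1 ≤ t k := fun k => ht0 ▸ htm.monotone (Nat.zero_le k)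
  have hk : ∀ k, BddAbove ((fun s => s * leftDeriv μt s / μt s) '' Set.Icc 1 (t k)) := by
    intro k
    induction k with
    | zero => rw [ht0, Set.Icc_self, Set.image_singleton]; exact bddAbove_singleton
    | succ k ih =>
      have hlt : t k < t (k + 1) := htm (Nat.lt_succ_self k)
      rw [← Set.Icc_union_Ioc_eq_Icc (h1t k) hlt.le, Set.image_union]
      refine ih.union ?_
      have hcont : ContinuousOn
          (fun s => s * derivWithin μt (Set.Icc (t k) (t (k + 1))) s / μt s)
          (Set.Icc (t k) (t (k + 1))) := by
        refine (continuousOn_id.mul ((hC k).continuousOn_derivWithin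
          (uniqueDiffOn_Icc hlt) le_rfl)).div
          (h.cont.mono fun s hs => (h1t k).trans hs.1) fun s hs => ?_
        exact (h.pos s ((h1t k).trans hs.1)).ne'
      refine (isCompact_Icc.bddAbove_image hcont).mono ?_
      rintro _ ⟨s, hs, rfl⟩
      refine ⟨s, ⟨hs.1.le, hs.2⟩, ?_⟩
      simp only
      rw [leftDeriv_eq_derivWithin_Icc (h1t k) (hC k) hs]
  obtain ⟨k, hk'⟩ := (htt.eventually_ge_atTop P).exists
  exact (hk k).mono (Set.image_mono (Set.Icc_subset_Icc_right hk'))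

/-- Inside a piece the derivative is (s μt'(s) / μt(s) - γ) / s ≤ 0; the pieces are glued at their
common end points. -/
lemma IsWeightInterpolation.antitoneOn_log_sub (h : IsWeightInterpolation μ μt) (p : ℕ) :
    AntitoneOn (fun s => Real.log (μt s) - gammaConst μt p * Real.log s) (Set.Icc 1 p) := by
  obtain ⟨t, ht0, htm, htt, hC⟩ := h.piecewise
  have h1t : ∀ k, 1 ≤ t k := fun k => ht0 ▸ htm.monotone (Nat.zero_le k)
  set ψ := fun s => Real.log (μt s) - gammaConst μt p * Real.log s with hψ
  have hcont : ContinuousOn ψ (Set.Ici 1) := by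
    refine (h.cont.log fun s hs => (h.pos s hs).ne').sub
      (continuousOn_const.mul (Real.continuousOn_log.mono fun s hs => ?_))
    have : (1 : ℝ) ≤ s := hs
    simp only [Set.mem_compl_iff, Set.mem_singleton_iff]
    linarith
  have hpiece : ∀ k, ∀ c ≤ t (k + 1), c ≤ p → AntitoneOn ψ (Set.Icc (t k) c) := by
    intro k c hc hcp
    refine antitoneOn_of_deriv_nonpos (convex_Icc _ _)
      (hcont.mono fun s hs => (h1t k).trans hs.1) ?_ ?_
    all_goals
      rw [interior_Icc]
    · intro s hs
      have h1s : 1 < s := (h1t k).trans_lt hs.1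
      have hnhds : Set.Icc (t k) (t (k + 1)) ∈ nhds s :=
        Icc_mem_nhds hs.1 (hs.2.trans_le hc)
      have hd : DifferentiableAt ℝ μt s :=
        ((hC k).contDiffAt hnhds).differentiableAt one_ne_zero
      exact ((hd.log (h.pos s h1s.le).ne').sub
        ((Real.differentiableAt_log (by linarith)).const_mul _)).differentiableWithinAt
    · intro s hs
      have h1s : 1 < s := (h1t k).trans_lt hs.1
      have hs0 : 0 < s := by linarith
      have hnhds : Set.Icc (t k) (t (k + 1)) ∈ nhds s :=
        Icc_mem_nhds hs.1 (hs.2.trans_le hc)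
      have hd : DifferentiableAt ℝ μt s :=
        ((hC k).contDiffAt hnhds).differentiableAt one_ne_zero
      have hpos := h.pos s h1s.le
      have hder : HasDerivAt ψ (deriv μt s / μt s - gammaConst μt p * s⁻¹) s :=
        (hd.hasDerivAt.log hpos.ne').sub ((Real.hasDerivAt_log hs0.ne').const_mul _)
      have hleft : leftDeriv μt s = deriv μt s := by
        rw [leftDeriv_eq_derivWithin_Icc (h1t k) (hC k) ⟨hs.1, (hs.2.trans_le hc).le⟩,
          derivWithin_of_mem_nhds hnhds]
      have hle : s * leftDeriv μt s / μt s ≤ gammaConst μt p :=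
        le_csSup (h.bddAbove p) ⟨s, ⟨h1s.le, hs.2.le.trans hcp⟩, rfl⟩
      rw [hder.deriv, sub_nonpos, ← div_eq_mul_inv, le_div_iff₀ hs0, ← hleft]
      calc leftDeriv μt s / μt s * s = s * leftDeriv μt s / μt s := by ring
        _ ≤ _ := hle
  have hk : ∀ k, ∀ c ≤ t k, c ≤ p → AntitoneOn ψ (Set.Icc 1 c) := by
    intro k
    induction k with
    | zero =>
      intro c hc _ x hx y hy _
      rw [ht0] at hc
      rw [show x = y by linarith [hx.1, hx.2, hy.1, hy.2]]
    | succ k ih =>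
      intro c hc hcp
      rcases le_total c (t k) with h1 | h1
      · exact ih c h1 hcp
      · rw [← Set.Icc_union_Icc_eq_Icc (h1t k) h1]
        exact (ih (t k) le_rfl (h1.trans hcp)).union_right (hpiece k c hc hcp)
          (isGreatest_Icc (h1t k)) (isLeast_Icc h1)
  obtain ⟨k, hk'⟩ := (htt.eventually_ge_atTop (p : ℝ)).exists
  exact hk k p hk' le_rfl

lemma IsWeightInterpolation.gammaConst_nonneg (h : IsWeightInterpolation μ μt) {p : ℕ}
    (hp : 2 ≤ p) : 0 ≤ gammaConst μt p := by
  have hp' : (2 : ℝ) ≤ p := by exact_mod_cast hp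
  have h1 := h.antitoneOn_log_sub p ⟨le_rfl, by linarith⟩ ⟨by linarith, le_rfl⟩
    (by linarith : (1 : ℝ) ≤ p)
  have h2 : Real.log (μt 1) ≤ Real.log (μt p) :=
    Real.log_le_log (h.pos 1 le_rfl) (h.mono (Set.mem_Ici.2 le_rfl)
      (Set.mem_Ici.2 (by linarith)) (by linarith))
  simp only [Real.log_one, mul_zero, sub_zero] at h1
  have h3 : 0 < Real.log p := Real.log_pos (by linarith)
  by_contra! hneg
  nlinarith

lemma IsWeightInterpolation.le_mul_rpow (h : IsWeightInterpolation μ μt) {p i : ℕ} (hi : 1 ≤ i)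
    (hip : i ≤ p) : μ p ≤ μ i * ((p : ℝ) / i) ^ gammaConst μt p := by
  have hi' : (1 : ℝ) ≤ i := by exact_mod_cast hi
  have hip' : (i : ℝ) ≤ p := by exact_mod_cast hip
  have h1 := h.antitoneOn_log_sub p ⟨hi', hip'⟩ ⟨hi'.trans hip', le_rfl⟩ hip'
  simp only at h1
  rw [← h.interp i hi, ← h.interp p (hi.trans hip)] at h1
  have hμi : 0 < μ i := by rw [h.interp i hi]; exact h.pos _ hi'
  have hμp : 0 < μ p := by rw [h.interp p (hi.trans hip)]; exact h.pos _ (hi'.trans hip')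
  have hi0 : (0 : ℝ) < i := by linarith
  have hp0 : (0 : ℝ) < p := by linarith
  have hquot : 0 < (p : ℝ) / i := by positivity
  rw [← Real.log_le_log_iff hμp (by positivity), Real.log_mul hμi.ne' (by positivity),
    Real.log_rpow hquot, Real.log_div hp0.ne' hi0.ne']
  linarith

end WeightInterpolation

/-! ### Polar coordinates and densities along rays -/

section Rays
variable {d : ℕ}

/-- Polar coordinates centred at x: translate x to the origin and drop that single null point. -/
lemma volume_eq_lintegral_rays {A : Set (EuclideanSpace ℝ (Fin d))} (hd : 1 ≤ d)
    (hA : MeasurableSet A) (x : EuclideanSpace ℝ (Fin d)) :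
    volume A = ∫⁻ θ : Metric.sphere (0 : EuclideanSpace ℝ (Fin d)) 1,
      Measure.volumeIoiPow (d - 1) {r | x + r.1 • θ.1 ∈ A}
        ∂(volume : Measure (EuclideanSpace ℝ (Fin d))).toSphere := by
  have : Nonempty (Fin d) := ⟨⟨0, hd⟩⟩
  set B := (fun y => x + y) ⁻¹' A with hB
  have hBm : MeasurableSet B := hA.preimage (measurable_const_add x)
  have hBvol : volume B = volume A := measure_preimage_add volume x A
  have hmp := (volume : Measure (EuclideanSpace ℝ (Fin d))).measurePreserving_homeomorphUnitSphereProd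
  rw [finrank_euclideanSpace_fin] at hmp
  set S : Set (Metric.sphere (0 : EuclideanSpace ℝ (Fin d)) 1 × Set.Ioi (0 : ℝ)) :=
    {p | x + p.2.1 • p.1.1 ∈ A} with hS
  have hSm : MeasurableSet S := by
    refine hA.preimage (Continuous.measurable ?_)
    fun_prop
  have hpre : homeomorphUnitSphereProd (EuclideanSpace ℝ (Fin d)) ⁻¹' S =
      (Subtype.val ⁻¹' B : Set ({0}ᶜ : Set (EuclideanSpace ℝ (Fin d)))) := by
    ext y
    have hy : ‖y.1‖ ≠ 0 := norm_ne_zero_iff.2 y.2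
    simp only [hS, hB, Set.mem_preimage, Set.mem_ofPred_eq, homeomorphUnitSphereProd_apply_fst_coe,
      homeomorphUnitSphereProd_apply_snd_coe, smul_smul, mul_inv_cancel₀ hy, one_smul]
  have h1 := hmp.measure_preimage hSm.nullMeasurableSet
  rw [hpre, comap_subtype_coe_apply (measurableSet_singleton _).compl,
    Subtype.image_preimage_coe, Measure.prod_apply hSm] at h1
  rw [← hBvol, ← measure_sdiff_null (s := B) (measure_singleton (0 : EuclideanSpace ℝ (Fin d))),
    Set.sdiff_eq, Set.inter_comm, h1]
  rfl

lemma volume_le_mul_of_rays {A L : Set (EuclideanSpace ℝ (Fin d))} (hd : 1 ≤ d)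
    (hA : MeasurableSet A) (hL : MeasurableSet L) (x : EuclideanSpace ℝ (Fin d)) {c : ENNReal}
    (hc : c ≠ ⊤)
    (h : ∀ θ : EuclideanSpace ℝ (Fin d), ‖θ‖ = 1 →
      Measure.volumeIoiPow (d - 1) {r | x + r.1 • θ ∈ A} ≤
        c * Measure.volumeIoiPow (d - 1) {r | x + r.1 • θ ∈ L}) :
    volume A ≤ c * volume L := by
  rw [volume_eq_lintegral_rays hd hA x, volume_eq_lintegral_rays hd hL x,
    ← lintegral_const_mul' _ _ hc]
  exact lintegral_mono fun θ => h θ.1 (by simp)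

lemma volumeIoiPow_le {n : ℕ} {S : Set (Set.Ioi (0 : ℝ))} (hS : MeasurableSet S) {R : ℝ}
    (hSR : ∀ r ∈ S, r.1 ≤ R) :
    Measure.volumeIoiPow n S ≤ ENNReal.ofReal (R ^ n) * volume (Subtype.val '' S) := by
  rw [Measure.volumeIoiPow, withDensity_apply _ hS]
  calc ∫⁻ r in S, ENNReal.ofReal (r.1 ^ n) ∂(Measure.comap Subtype.val volume)
      ≤ ∫⁻ r in S, ENNReal.ofReal (R ^ n) ∂(Measure.comap Subtype.val volume) := by
        refine setLIntegral_mono' hS fun r hr => ?_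
        have : 0 ≤ r.1 := le_of_lt r.2
        exact ENNReal.ofReal_le_ofReal (pow_le_pow_left₀ this (hSR r hr) n)
    _ = _ := by
        rw [setLIntegral_const, comap_subtype_coe_apply measurableSet_Ioi]

/-- If in each ray from a point `x` of the convex body `L` the set `A` has density at most `κ`,
then `A` has density at most `κ d` in `L`. -/
lemma volume_le_mul_of_ray_density (hd : 1 ≤ d) {A L : Set (EuclideanSpace ℝ (Fin d))}
    (hA : IsCompact A) (hAL : A ⊆ L) (hL : IsCompact L) (hLc : Convex ℝ L)
    {x : EuclideanSpace ℝ (Fin d)} (hx : x ∈ L) {κ : ℝ} (hκ : 0 ≤ κ)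
    (h : ∀ (θ : EuclideanSpace ℝ (Fin d)) (R : ℝ), ‖θ‖ = 1 → 0 < R →
      (∀ r ∈ Set.Icc 0 R, x + r • θ ∈ L) →
      volume.real {r | r ∈ Set.Icc 0 R ∧ x + r • θ ∈ A} ≤ κ * R) :
    volume A ≤ ENNReal.ofReal (κ * d) * volume L := by
  refine volume_le_mul_of_rays hd hA.measurableSet hL.measurableSet x ENNReal.ofReal_ne_top ?_
  intro θ hθ
  have hcont : Continuous fun r : ℝ => x + r • θ := by fun_prop
  set T : Set ℝ := {r | 0 ≤ r ∧ x + r • θ ∈ L} with hT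
  have hTcl : IsClosed T := isClosed_Ici.inter (hL.isClosed.preimage hcont)
  have hTb : Bornology.IsBounded T := by
    refine (Metric.isBounded_Icc 0 (Metric.diam L)).subset fun r hr => ⟨hr.1, ?_⟩
    have := Metric.dist_le_diam_of_mem hL.isBounded hr.2 hx
    rwa [dist_self_add_left, norm_smul, hθ, mul_one, Real.norm_of_nonneg hr.1] at this
  have hTc : IsCompact T := Metric.isCompact_of_isClosed_isBounded hTcl hTb
  have h0T : (0 : ℝ) ∈ T := ⟨le_rfl, by simpa using hx⟩
  -- R is the radius at which the ray leaves L; by convexity the ray meets L exactly in [0, R].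
  obtain ⟨R, hRT, hR⟩ := hTc.exists_isGreatest ⟨0, h0T⟩
  have hseg : ∀ r ∈ Set.Icc 0 R, x + r • θ ∈ L := by
    intro r hr
    rcases hRT.1.eq_or_lt with h0 | h0
    · have : r = 0 := by linarith [hr.1, hr.2]
      simpa [this] using hx
    · have := hLc.add_smul_sub_mem hx hRT.2 (t := r / R)
        ⟨div_nonneg hr.1 h0.le, (div_le_one h0).2 hr.2⟩
      rwa [add_sub_cancel_left, smul_smul, div_mul_cancel₀ _ h0.ne'] at this
  have hSm : MeasurableSet {r : Set.Ioi (0 : ℝ) | x + r.1 • θ ∈ A} :=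
    hA.measurableSet.preimage (hcont.comp continuous_subtype_val).measurable
  have hSR : ∀ r ∈ {r : Set.Ioi (0 : ℝ) | x + r.1 • θ ∈ A}, r.1 ≤ R :=
    fun r hr => hR ⟨le_of_lt r.2, hAL hr⟩
  rcases hRT.1.eq_or_lt with h0 | h0
  · have : {r : Set.Ioi (0 : ℝ) | x + r.1 • θ ∈ A} = ∅ := by
      refine Set.eq_empty_of_forall_notMem fun r hr => ?_
      have h1 := hSR r hr
      have h2 : 0 < r.1 := r.2
      linarith
    simp [this]
  · have hfin : volume {r | r ∈ Set.Icc 0 R ∧ x + r • θ ∈ A} ≠ ⊤ :=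
      ((measure_mono fun r hr => hr.1).trans_lt measure_Icc_lt_top).ne
    have h1 : volume (Subtype.val '' {r : Set.Ioi (0 : ℝ) | x + r.1 • θ ∈ A}) ≤
        ENNReal.ofReal (κ * R) := by
      refine (measure_mono (t := {r | r ∈ Set.Icc 0 R ∧ x + r • θ ∈ A}) ?_).trans ?_
      · rintro _ ⟨r, hr, rfl⟩
        exact ⟨⟨le_of_lt r.2, hSR r hr⟩, hr⟩
      · rw [← ENNReal.ofReal_toReal hfin]
        exact ENNReal.ofReal_le_ofReal (h θ R hθ h0 hseg)
    -- The weight r^(d-1) has mass R^d / d on [0, R], whereas the part in A has mass at most R^(d-1)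
    -- · κR. The quotient is κd.
    have h2 : ENNReal.ofReal (R ^ (d - 1 + 1) / ((d - 1 : ℕ) + 1)) ≤
        Measure.volumeIoiPow (d - 1) {r | x + r.1 • θ ∈ L} := by
      rw [← Measure.volumeIoiPow_apply_Iio (d - 1) ⟨R, h0⟩]
      refine measure_mono fun r hr => hseg r.1 ⟨le_of_lt r.2, le_of_lt hr⟩
    refine (volumeIoiPow_le hSm hSR).trans ?_
    calc ENNReal.ofReal (R ^ (d - 1)) *
          volume (Subtype.val '' {r : Set.Ioi (0 : ℝ) | x + r.1 • θ ∈ A})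
        ≤ ENNReal.ofReal (R ^ (d - 1)) * ENNReal.ofReal (κ * R) := by gcongr
      _ = ENNReal.ofReal (κ * d) * ENNReal.ofReal (R ^ (d - 1 + 1) / ((d - 1 : ℕ) + 1)) := by
        have hd' : (((d - 1 : ℕ) : ℝ) + 1) = d := by
          rw [Nat.cast_sub hd]; push_cast; ring
        have hd0 : (0 : ℝ) < d := by exact_mod_cast hd
        rw [← ENNReal.ofReal_mul (by positivity), ← ENNReal.ofReal_mul (by positivity), hd']
        congr 1
        field_simp
        ring
      _ ≤ _ := by gcongr

end Rays

/-! ### The Remez inequality on a convex body -/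

/-- The defining property of the integer `N` in admissible data. -/
lemma IsAdmissibleData.exp_mul_diam_le {d : ℕ} {μ : ℕ → ℝ} {K : Set (EuclideanSpace ℝ (Fin d))}
    {N : ℕ} (h : IsAdmissibleData μ K N) :
    Real.exp 1 * Metric.diam K ≤ ∑ i ∈ Finset.Icc 1 (N - 1 + 1), 1 / μ i := by
  have hint := h.integer
  have hdeg : weightDegree (fun j => Metric.diam K * μ j) 1 = ((N - 1 : ℕ) : ℕ∞) := by
    generalize weightDegree (fun j => Metric.diam K * μ j) 1 = D at hint ⊢
    cases D using ENat.recTopCoe with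
    | top => simp at hint
    | coe D =>
      have : N = D + 1 := by exact_mod_cast hint
      rw [this, Nat.add_sub_cancel]
  have hnot : ¬ ∑ j ∈ Finset.Icc (jZero 1 + 1) (N - 1 + 1),
      1 / (Metric.diam K * μ j) < Real.exp 1 := by
    intro hlt
    have : ((N - 1 + 1 : ℕ) : ℕ∞) ≤ weightDegree (fun j => Metric.diam K * μ j) 1 :=
      le_iSup₂_of_le (f := fun (n : ℕ) (_ : n ∈ {n : ℕ | ∑ j ∈ Finset.Icc (jZero 1 + 1) n,
        1 / (Metric.diam K * μ j) < Real.exp 1}) => (n : ℕ∞)) (N - 1 + 1) hlt le_rfl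
    rw [hdeg] at this
    have : N - 1 + 1 ≤ N - 1 := by exact_mod_cast this
    omega
  rw [not_lt] at hnot
  have hj : jZero 1 = 0 := by simp [jZero]
  rw [hj, zero_add] at hnot
  -- If the diameter vanished, division by zero would make every term 0, contradicting the lower
  -- bound e.
  rcases (Metric.diam_nonneg (s := K)).eq_or_lt with h0 | h0
  · simp only [← h0, zero_mul, div_zero, Finset.sum_const_zero] at hnot
    exact absurd hnot (not_le.2 (Real.exp_pos 1))
  · calc Real.exp 1 * Metric.diam K
        ≤ (∑ j ∈ Finset.Icc 1 (N - 1 + 1), 1 / (Metric.diam K * μ j)) * Metric.diam K := by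
          gcongr
      _ = _ := by
        rw [Finset.sum_mul]
        refine Finset.sum_congr rfl fun j _ => ?_
        rw [one_div, mul_inv, mul_right_comm, inv_mul_cancel₀ h0.ne', one_mul, one_div]

lemma IsWeightSmooth.continuousOn {d : ℕ} {μ : ℕ → ℝ} {n : ℕ} {M₀ : ℝ}
    {K : Set (EuclideanSpace ℝ (Fin d))} {f : EuclideanSpace ℝ (Fin d) → ℝ}
    (hf : IsWeightSmooth μ n M₀ K f) : ContinuousOn f K := by
  obtain ⟨U, _, hKU, hC⟩ := hf.contDiff
  exact hC.continuousOn.mono hKU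

/-- **Remez inequality on a convex body**, for the sublevel sets of `f`. -/
theorem volume_sublevel_le {d : ℕ} (hd : 1 ≤ d) {μ : ℕ → ℝ} {μt : ℝ → ℝ}
    (hμt : IsWeightInterpolation μ μt) {K : Set (EuclideanSpace ℝ (Fin d))} {N : ℕ}
    (hdata : IsAdmissibleData μ K N) {f : EuclideanSpace ℝ (Fin d) → ℝ}
    (hf : IsWeightSmooth μ (2 * (N - 1)) (supNormOn K f) K f)
    {L : Set (EuclideanSpace ℝ (Fin d))} (hL : IsConvexBody L) (hLK : L ⊆ K)
    (hnorm : supNormOn L f = supNormOn K f) (hN : N - 1 ≠ 0) {η : ℝ} (hη : 0 ≤ η) :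
    volume {x | x ∈ L ∧ |f x| ≤ supNormOn K f * η ^ (2 * (N - 1))} ≤
      ENNReal.ofReal (capGammaConst μt (2 * (N - 1)) * d * η) * volume L := by
  set n := N - 1 with hn
  set M := supNormOn K f with hM
  set Γ := capGammaConst μt (2 * n) with hΓ
  have hΓ0 : 0 < Γ := by rw [hΓ, capGammaConst]; positivity
  have hM0 : 0 < M := hf.pos
  obtain ⟨U, hU, hKU, hC⟩ := hf.contDiff
  have hfL : ContinuousOn f L := hf.continuousOn.mono hLK
  -- The rays start at a maximum point of |f| on L. There |f| = M because the sup-norms over L and K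
  -- agree, as Bang's argument requires.
  obtain ⟨x, hxL, hx⟩ := hL.isCompact.exists_isMaxOn
    (hL.nonempty_interior.mono interior_subset) hfL.abs
  have hfx : |f x| = M := by
    rw [← hnorm]
    refine le_antisymm (abs_le_supNormOn hL.isCompact hfL hxL) ?_
    refine csSup_le ⟨_, x, hxL, rfl⟩ ?_
    rintro _ ⟨y, hy, rfl⟩
    exact hx hy
  have hAc : IsCompact {x | x ∈ L ∧ |f x| ≤ M * η ^ (2 * n)} := by
    have := hfL.abs.preimage_isClosed_of_isClosed hL.isCompact.isClosed
      (isClosed_Iic (a := M * η ^ (2 * n)))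
    exact hL.isCompact.of_isClosed_subset this Set.inter_subset_left
  have key := volume_le_mul_of_ray_density hd hAc (fun y hy => hy.1) hL.isCompact hL.convex hxL
    (κ := Γ * η) (by positivity) ?_
  · rwa [mul_right_comm] at key
  intro θ R hθ hR hseg
  have hsegK : ∀ r ∈ Set.Icc 0 R, x + r • θ ∈ K := fun r hr => hLK (hseg r hr)
  have hchain := isDerivChain_iteratedFDeriv hU hC x θ (s := Set.Icc 0 R)
    fun r hr => hKU (hsegK r hr)
  have hcont : Continuous fun r : ℝ => x + r • θ := by fun_prop
  have hRdiam : R ≤ Metric.diam K := by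
    have := Metric.dist_le_diam_of_mem hdata.body.isCompact.isBounded
      (hsegK R ⟨hR.le, le_rfl⟩) (hLK hxL)
    rwa [dist_self_add_left, norm_smul, hθ, mul_one, Real.norm_of_nonneg hR.le] at this
  have hbound : ∀ j ≤ 2 * n, ∀ r ∈ Set.Icc 0 R,
      |iteratedFDeriv ℝ j f (x + r • θ) (fun _ => θ) / M| ≤ weightProd μ j := by
    intro j hj r hr
    rw [abs_div, abs_of_pos hM0, div_le_iff₀ hM0, mul_comm]
    exact (abs_iteratedFDeriv_le_derivNormOn hU hC hdata.body.isCompact hKU hj hθ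
      (hsegK r hr)).trans (hf.bound j hj)
  have hE : IsCompact {r | r ∈ Set.Icc 0 R ∧
      x + r • θ ∈ {x | x ∈ L ∧ |f x| ≤ M * η ^ (2 * n)}} :=
    isCompact_Icc.inter_right (hAc.isClosed.preimage hcont)
  have hremez := IsDerivChain.remez (G := fun j r =>
      iteratedFDeriv ℝ j f (x + r • θ) (fun _ => θ) / M) hdata.weight
    (hμt.gammaConst_nonneg (p := 2 * n) (by omega)) (n := n) (by omega)
    (fun i hi hin => hμt.le_mul_rpow hi hin) hR
    (fun j hj r hr => (hchain j hj r hr).div_const M) hbound (by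
      simp [abs_div, hfx, abs_of_pos hM0, div_self hM0.ne'])
    ((mul_le_mul_of_nonneg_left hRdiam (Real.exp_pos 1).le).trans (hdata.exp_mul_diam_le))
    hE (fun r hr => hr.1) (ε := η ^ (2 * n)) (by positivity) (fun r hr => by
      simp only [iteratedFDeriv_zero_apply]
      rw [abs_div, abs_of_pos hM0, div_le_iff₀ hM0, mul_comm]
      exact hr.2.2)
  -- The level was taken as η^(2n) so that the 2n-th root of the one-dimensional inequality is
  -- linear in η.
  have := le_of_pow_le_pow_left₀ (by omega) hη hremez
  rw [div_le_iff₀ (by positivity)] at this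
  rw [hΓ, capGammaConst]
  linarith

/-! ### From exponential tails to mean oscillation -/

/-- The first moment of a function with exponentially decaying distribution function. -/
lemma lintegral_ofReal_le_of_exp_tail {α : Type*} [MeasurableSpace α] {ν : Measure α}
    [IsFiniteMeasure ν] {u : α → ℝ} (hu : AEMeasurable u ν) (hu0 : 0 ≤ᵐ[ν] u) {B m : ℝ}
    (hB : 1 ≤ B) (hm : 0 < m)
    (h : ∀ t, 0 ≤ t → ν {x | t < u x} ≤ ENNReal.ofReal (B * Real.exp (-t / m)) * ν Set.univ) :
    ∫⁻ x, ENNReal.ofReal (u x) ∂ν ≤ ENNReal.ofReal (m * (Real.log B + 1)) * ν Set.univ := by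
  have hT : 0 ≤ m * Real.log B := mul_nonneg hm.le (Real.log_nonneg hB)
  have hneg : -m⁻¹ < 0 := by rw [neg_lt_zero]; positivity
  -- The layer-cake integral is split at t = m log B, where B e^(-t/m) = 1. Below it the total mass
  -- bounds the distribution function; above it the exponential integrates to m.
  rw [lintegral_eq_lintegral_meas_lt ν hu0 hu, ← Set.Ioc_union_Ioi_eq_Ioi hT]
  refine (lintegral_union_le _ _ _).trans ?_
  have h1 : ∫⁻ t in Set.Ioc 0 (m * Real.log B), ν {x | t < u x} ≤
      ENNReal.ofReal (m * Real.log B) * ν Set.univ := by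
    calc _ ≤ ∫⁻ t in Set.Ioc 0 (m * Real.log B), ν Set.univ :=
          lintegral_mono fun t => measure_mono (Set.subset_univ _)
      _ = _ := by rw [setLIntegral_const, Real.volume_Ioc, sub_zero, mul_comm]
  have h2 : ∫⁻ t in Set.Ioi (m * Real.log B), ν {x | t < u x} ≤
      ENNReal.ofReal m * ν Set.univ := by
    calc _ ≤ ∫⁻ t in Set.Ioi (m * Real.log B),
          ENNReal.ofReal (B * Real.exp (-m⁻¹ * t)) * ν Set.univ := by
          refine setLIntegral_mono' measurableSet_Ioi fun t ht => ?_
          have := h t (hT.trans (le_of_lt ht))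
          rwa [show -t / m = -m⁻¹ * t by ring] at this
      _ = (∫⁻ t in Set.Ioi (m * Real.log B), ENNReal.ofReal (B * Real.exp (-m⁻¹ * t))) *
          ν Set.univ := lintegral_mul_const' _ _ (measure_ne_top _ _)
      _ = _ := by
        congr 1
        rw [← ofReal_integral_eq_lintegral_ofReal ((integrableOn_exp_mul_Ioi hneg _).const_mul B)
          (Filter.Eventually.of_forall fun t => by positivity), integral_const_mul,
          integral_exp_mul_Ioi hneg, show -m⁻¹ * (m * Real.log B) = -Real.log B by field_simp,
          Real.exp_neg, Real.exp_log (by linarith)]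
        congr 1
        field_simp
  refine (add_le_add h1 h2).trans (le_of_eq ?_)
  rw [← add_mul, ← ENNReal.ofReal_add hT hm.le]
  congr 2
  ring

/-- Here |g - avg g| = |u - avg u| ≤ u + avg u almost everywhere, since both terms are nonnegative.
-/
lemma average_abs_sub_average_le {α : Type*} [MeasurableSpace α] {ν : Measure α}
    [IsFiniteMeasure ν] [NeZero ν] {g u : α → ℝ} {c : ℝ} (hu : Integrable u ν) (hu0 : 0 ≤ᵐ[ν] u)
    (hg : ∀ x, g x = c - u x) : ⨍ x, |g x - ⨍ y, g y ∂ν| ∂ν ≤ 2 * ⨍ x, u x ∂ν := by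
  have hpos : 0 < ν.real Set.univ := measureReal_univ_pos
  set ū := ⨍ x, u x ∂ν with hū
  have hū0 : 0 ≤ ū := by
    rw [hū, average_eq, smul_eq_mul]
    exact mul_nonneg (by positivity) (integral_nonneg_of_ae hu0)
  have hgavg : ⨍ y, g y ∂ν = c - ū := by
    rw [hū, average_eq, average_eq, integral_congr_ae (Filter.Eventually.of_forall hg),
      integral_sub (integrable_const c) hu, integral_const, smul_eq_mul, smul_eq_mul, smul_eq_mul]
    field_simp
  rw [hgavg]
  have h1 : ∫ x, |g x - (c - ū)| ∂ν ≤ ∫ x, (u x + ū) ∂ν := by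
    refine integral_mono_of_nonneg (Filter.Eventually.of_forall fun x => abs_nonneg _)
      (hu.add (integrable_const ū)) ?_
    filter_upwards [hu0] with x hx
    have hx : 0 ≤ u x := hx
    rw [hg x, abs_le]
    constructor <;> linarith
  rw [integral_add hu (integrable_const ū), integral_const, smul_eq_mul] at h1
  have h2 : ∫ x, u x ∂ν = ν.real Set.univ * ū := by
    rw [hū, average_eq, smul_eq_mul]; field_simp
  rw [average_eq, smul_eq_mul, inv_mul_le_iff₀ hpos]
  linarith

/-- In the constant 4(N - 1), the factor 2(N - 1) is the decay length of the tail of u and the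
remaining 2 comes from `average_abs_sub_average_le`. -/
theorem mainTheorem10 (d : ℕ) (hd : 1 ≤ d) (μ : ℕ → ℝ) (μt : ℝ → ℝ)
    (hμt : IsWeightInterpolation μ μt)
    (K : Set (EuclideanSpace ℝ (Fin d))) (N : ℕ) (hdata : IsAdmissibleData μ K N)
    (f : EuclideanSpace ℝ (Fin d) → ℝ)
    (hf : IsWeightSmooth μ (2 * (N - 1)) (supNormOn K f) K f)
    (L : Set (EuclideanSpace ℝ (Fin d))) (hL : IsConvexBody L) (hLK : L ⊆ K)
    (hnorm : supNormOn L f = supNormOn K f) (hN : N - 1 ≠ 0) :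
    IntegrableOn (fun x => Real.log |f x|) L ∧
      meanOscillation L (fun x => Real.log |f x|) ≤
        4 * ((N : ℝ) - 1) * (Real.log (capGammaConst μt (2 * (N - 1)) * d) + 1) := by
  have hremez := fun {η : ℝ} (hη : 0 ≤ η) =>
    volume_sublevel_le hd hμt hdata hf hL hLK hnorm hN hη
  have hγ := hμt.gammaConst_nonneg (p := 2 * (N - 1)) (by omega)
  set n := N - 1 with hn
  set M := supNormOn K f with hM
  set B := capGammaConst μt (2 * n) * d with hB
  have hM0 : 0 < M := hf.pos
  have hd' : (1 : ℝ) ≤ d := by exact_mod_cast hd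
  have hB1 : 1 ≤ B := by
    have h1 : 1 ≤ Real.exp (4 + gammaConst μt (2 * n)) := Real.one_le_exp (by linarith)
    rw [hB, capGammaConst]
    nlinarith
  have hLm : MeasurableSet L := hL.isCompact.measurableSet
  have hLpos : 0 < volume L := Measure.measure_pos_of_nonempty_interior _ hL.nonempty_interior
  set ν := volume.restrict L with hν
  have hνuniv : ν Set.univ = volume L := Measure.restrict_apply_univ L
  have hfin : IsFiniteMeasure ν := ⟨by rw [hνuniv]; exact hL.isCompact.measure_lt_top⟩
  have hne : NeZero ν := ⟨fun h0 => by rw [h0] at hνuniv; simp [← hνuniv] at hLpos⟩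
  have hfL : ContinuousOn f L := hf.continuousOn.mono hLK
  set u := fun x => Real.log M - Real.log |f x| with hu
  have hfm : AEMeasurable f ν := hfL.aemeasurable hLm
  have hum : AEMeasurable u ν :=
    aemeasurable_const.sub (Real.measurable_log.comp_aemeasurable
      (measurable_norm.comp_aemeasurable hfm))
  -- The Remez inequality with η = 0 shows that the zero set is null, so the convention log 0 = 0
  -- does not affect the integrals.
  have hnull : ν {x | f x = 0} = 0 := by
    rw [hν, Measure.restrict_apply' hLm]
    refine measure_mono_null ?_ (nonpos_iff_eq_zero.1 ((hremez le_rfl).trans (by simp)))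
    rintro x ⟨hx, hxL⟩
    have hx : f x = 0 := hx
    exact ⟨hxL, by rw [hx, abs_zero]; positivity⟩
  have hu0 : 0 ≤ᵐ[ν] u := by
    have h1 : ∀ᵐ x ∂ν, x ∈ L := ae_restrict_mem hLm
    have h2 : ∀ᵐ x ∂ν, f x ≠ 0 := by rw [ae_iff]; simpa using hnull
    filter_upwards [h1, h2] with x hxL hx
    exact sub_nonneg.2 (Real.log_le_log (abs_pos.2 hx)
      (abs_le_supNormOn hdata.body.isCompact hf.continuousOn (hLK hxL)))
  have hn0 : (0 : ℝ) < n := by exact_mod_cast Nat.pos_of_ne_zero hN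
  have htail : ∀ t, 0 ≤ t →
      ν {x | t < u x} ≤ ENNReal.ofReal (B * Real.exp (-t / (2 * n))) * ν Set.univ := by
    intro t _
    rw [hνuniv, hν, Measure.restrict_apply' hLm]
    refine (measure_mono ?_).trans (hremez (Real.exp_pos (-t / (2 * n))).le)
    rintro x ⟨hx, hxL⟩
    refine ⟨hxL, ?_⟩
    have hx : t < Real.log M - Real.log |f x| := hx
    rw [← Real.exp_nat_mul]
    have h1 : ((2 * n : ℕ) : ℝ) * (-t / (2 * n)) = -t := by push_cast; field_simp
    rw [h1]
    -- At a zero of f the hypothesis t < u x carries no information because log 0 = 0, but the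
    -- required bound on |f x| is trivial.
    rcases (abs_nonneg (f x)).eq_or_lt with h0 | h0
    · rw [← h0]; positivity
    · rw [← Real.log_le_log_iff h0 (by positivity), Real.log_mul hM0.ne' (Real.exp_pos _).ne',
        Real.log_exp]
      linarith
  have hlint := lintegral_ofReal_le_of_exp_tail hum hu0 hB1 (by positivity : (0 : ℝ) < 2 * n) htail
  have hui : Integrable u ν := by
    refine ⟨hum.aestronglyMeasurable, ?_⟩
    rw [hasFiniteIntegral_iff_ofReal hu0]
    exact hlint.trans_lt (ENNReal.mul_lt_top ENNReal.ofReal_lt_top (measure_lt_top _ _))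
  have hg : ∀ x, Real.log |f x| = Real.log M - u x := fun x => by rw [hu]; ring
  refine ⟨?_, ?_⟩
  · have : Integrable (fun x => Real.log M - u x) ν := (integrable_const _).sub hui
    exact this.congr (Filter.Eventually.of_forall fun x => (hg x).symm)
  · refine (average_abs_sub_average_le hui hu0 hg).trans ?_
    have hlog : 0 ≤ Real.log B := Real.log_nonneg hB1
    have hint : ∫ x, u x ∂ν ≤ 2 * n * (Real.log B + 1) * ν.real Set.univ := by
      rw [integral_eq_lintegral_of_nonneg_ae hu0 hum.aestronglyMeasurable]
      have := ENNReal.toReal_mono (ENNReal.mul_ne_top ENNReal.ofReal_ne_top (measure_ne_top _ _))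
        hlint
      rwa [ENNReal.toReal_mul, ENNReal.toReal_ofReal (by positivity)] at this
    have hpos : 0 < ν.real Set.univ := measureReal_univ_pos
    have havg : ⨍ x, u x ∂ν ≤ 2 * n * (Real.log B + 1) := by
      rw [average_eq, smul_eq_mul, inv_mul_le_iff₀ hpos]
      linarith
    have hNn : (N : ℝ) - 1 = n := by rw [hn, Nat.cast_sub (by omega)]; simp
    rw [hNn]
    linarith
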